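/- All graphs are finite and simple. For a graph $G$, $e(G)$ is its number of edges, $\delta(G)$ and $\Delta(G)$ its minimum and maximum degree, and $\gcd(G)$ is the greatest common divisor of its vertex degrees (with $\gcd(G)=0$, which is divisible by every integer, if $G$ has no edges). For a partition $\mathcal P$ of $V(G)$, $G[\mathcal P]$ is the spanning subgraph of $G$ consisting of the edges whose ends lie in different parts, and $G[U]$ is the subgraph induced by $U\subseteq V(G)$. A graph $G$ is $F$-divisible if $e(F)\mid e(G)$ and $\gcd(F)\mid\gcd(G)$; it has an $F$-decomposition if its edge set can be covered by pairwise edge-disjoint subgraphs of $G$, each isomorphic to $F$. Lemma 7.1. There is a function $n_0:\mathbb N\to\mathbb N$ such that for all integers $r,f\ge 1$ and every real $\varepsilon>0$ there is an $m_0$ such that the following holds for all integers $m\ge m_0$ and $n\ge n_0(m)$ (in short, $1/n\ll 1/m\ll 1/r,1/f,\varepsilon$). Let $\delta:=1-\frac{1}{3r}+\varepsilon$ and $q:=\lceil n/m\rceil$. Let $F$ be an $r$-regular graph on $f$ vertices, let $G$ be a graph on $n$ vertices, and let $\mathcal P=\{V_1,\dots,V_q\}$ be an equitable partition of $V(G)$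 with $|V_i|\in\{m,m-1\}$ for each $1\le i\le q$. Suppose that $\delta(G[\mathcal P])\ge\delta n$ and $\delta(G[V_i])\ge\delta|V_i|$ for each $1\le i\le q$. Then $G$ contains an $F$-divisible subgraph $A^*$ such that (i) $\Delta(A^*[\mathcal P])\le\varepsilon^2 n$ and $\Delta(A^*[V_i])\le r$ for each $1\le i\le q$; and (ii) if $H^*$ is an $F$-divisible graph on $V(G)$ that is edge-disjoint from $A^*$ and satisfies $e(H^*[\mathcal P])=0$, then $A^*\cup H^*$ has an $F$-decomposition. -/

import Mathlib

open scoped Classical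

namespace GraphDecomp

/-- `gcd(G)`: the greatest common divisor of the degrees of the vertices of `G`
(it is `0` if `G` has no edges, so that every integer divides it). -/
noncomputable def degreeGcd {V : Type*} [Fintype V] (G : SimpleGraph V) : ℕ :=
  Finset.univ.gcd fun v => G.degree v

/-- `G` is `F`-divisible: `e(F)` divides `e(G)` and `gcd(F)` divides `gcd(G)`. -/
def IsDivisible {W V : Type*} [Fintype W] [Fintype V]
    (F : SimpleGraph W) (G : SimpleGraph V) : Prop :=
  F.edgeFinset.card ∣ G.edgeFinset.card ∧ degreeGcd F ∣ degreeGcd G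

/-- `G` has an `F`-decomposition: there is a collection of pairwise edge-disjoint subgraphs of `G`,
each isomorphic to `F`, that together cover all the edges of `G`. -/
def HasDecomposition {W V : Type*} (F : SimpleGraph W) (G : SimpleGraph V) : Prop :=
  ∃ D : Set G.Subgraph,
    (∀ K ∈ D, Nonempty (F ≃g K.coe)) ∧
    (∀ K ∈ D, ∀ L ∈ D, K ≠ L → Disjoint K.edgeSet L.edgeSet) ∧
    (⋃ K ∈ D, K.edgeSet) = G.edgeSet

/-- `G[P]`: the multipartite subgraph of `G` induced by the partition `P` of its vertex set. It has
all the vertices of `G`, and those edges of `G` whose ends lie in different parts of `P`. -/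
def crossing {V : Type*} [Fintype V] (P : Finpartition (Finset.univ : Finset V))
    (G : SimpleGraph V) : SimpleGraph V where
  Adj u v := G.Adj u v ∧ P.part u ≠ P.part v
  symm := ⟨fun _ _ h => ⟨h.1.symm, h.2.symm⟩⟩
  loopless := ⟨fun _ h => h.2 rfl⟩

end GraphDecomp

/-!
A set of edges `T` absorbs `P` if both `T` and `T + P` decompose into copies of `F`. More generally,
`P` can be exchanged for `Q` if both `T + P` and `T + Q` decompose for some `T`. Exchanges can be
added, and edges that occur on both sides may become part of `T`, so absorbers can be built in small
steps. The basic step moves a star with `r` leaves, such as the edges at a vertex of `F`, from one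
centre to another. Stars in turn allow two edges to switch ends, and thus all ends of an edge set
with degrees divisible by `r` to be moved to a single new vertex. The result depends only on the
number of edges, so the edge set can be exchanged for disjoint copies of `F`. All gadgets are built
from new vertices with at most `3 * r` prescribed neighbours, which exist because of the minimum
degree; choosing them among the vertices of small degree in the earlier gadgets keeps the gadgets
edge-disjoint and the degrees small.

The part of `H` inside a class of the partition has one of boundedly many edge sets. Its degrees are
divisible by `r`, but the number of its edges need not be divisible by `e(F)`. Every class therefore
owns some carriers, whose degrees are divisible by `r` and whose number of edges is, modulo `e(F)`,
the divisor `g` of the number of edges that divisibility of the degrees forces. Some carriers of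
each class are absorbed with those of the preceding class instead, which shifts edges from class to
class and makes their numbers divisible by `e(F)` everywhere. The absorbing graph consists of the
carriers and an absorber for every edge set that can arise in this way.
-/

namespace GraphDecomp

section CopyEdges

variable {W V : Type*} [Fintype W] {F : SimpleGraph W}

/-- The edges of the image of `F` under a map of its vertices. Edge sets that take part in an
exchange are multisets, so that sums of overlapping edge sets keep track of multiplicities. -/
noncomputable def copyEdges (F : SimpleGraph W) (φ : W → V) : Multiset (Sym2 V) :=
  F.edgeFinset.val.map (Sym2.map φ)

/-- The multisets of edges that are sums of copies of `F`. -/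
noncomputable def decomposable (F : SimpleGraph W) (V : Type*) :
    AddSubmonoid (Multiset (Sym2 V)) :=
  AddSubmonoid.closure {M | ∃ φ : W → V, Function.Injective φ ∧ M = copyEdges F φ}

theorem copyEdges_mem_decomposable (F : SimpleGraph W) {φ : W → V} (hφ : Function.Injective φ) :
    copyEdges F φ ∈ decomposable F V :=
  AddSubmonoid.subset_closure ⟨φ, hφ, rfl⟩

theorem copyEdges_nodup (F : SimpleGraph W) {φ : W → V} (hφ : Function.Injective φ) :
    (copyEdges F φ).Nodup :=
  F.edgeFinset.nodup.map (Sym2.map.injective hφ)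

theorem mem_copyEdges {φ : W → V} {e : Sym2 V} :
    e ∈ copyEdges F φ ↔ ∃ a b, F.Adj a b ∧ e = s(φ a, φ b) := by
  simp only [copyEdges, Multiset.mem_map, Finset.mem_val, SimpleGraph.mem_edgeFinset, Sym2.exists,
    SimpleGraph.mem_edgeSet, Sym2.map_mk, eq_comm]

theorem card_copyEdges (F : SimpleGraph W) (φ : W → V) :
    Multiset.card (copyEdges F φ) = F.edgeFinset.card := by
  simp [copyEdges]

theorem map_copyEdges {U : Type*} (F : SimpleGraph W) (φ : W → V) (ψ : V → U) :
    (copyEdges F φ).map (Sym2.map ψ) = copyEdges F (ψ ∘ φ) := by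
  rw [copyEdges, copyEdges, Multiset.map_map, Sym2.map_comp]

theorem copyEdges_iso {W' : Type*} [Fintype W'] {F' : SimpleGraph W'} (e : F ≃g F') (φ : W' → V) :
    copyEdges F (φ ∘ e) = copyEdges F' φ := by
  have h : copyEdges F e = F'.edgeFinset.val := by
    refine ((copyEdges_nodup F e.injective).ext F'.edgeFinset.nodup).2 fun d => ?_
    induction d with
    | _ a b =>
      rw [mem_copyEdges, Finset.mem_val, SimpleGraph.mem_edgeFinset, SimpleGraph.mem_edgeSet]
      constructor
      · rintro ⟨x, y, hxy, hd⟩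
        rw [← SimpleGraph.mem_edgeSet, hd]
        exact e.map_adj_iff.2 hxy
      · exact fun hab => ⟨e.symm a, e.symm b, e.symm.map_adj_iff.2 hab, by simp⟩
  rw [← map_copyEdges, h, copyEdges]

end CopyEdges

section Multisets

variable {α ι : Type*}

theorem nodup_sum {s : Finset ι} {f : ι → Multiset α} (h : ∀ i ∈ s, (f i).Nodup)
    (hd : ∀ i ∈ s, ∀ j ∈ s, ∀ a, a ∈ f i → a ∈ f j → i = j) : (∑ i ∈ s, f i).Nodup := by
  induction s using Finset.induction_on with
  | empty => simp
  | insert i s hi ih =>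
    rw [Finset.sum_insert hi, Multiset.nodup_add]
    refine ⟨h i (Finset.mem_insert_self _ _), ih (fun j hj => h j (Finset.mem_insert_of_mem hj))
      fun j hj l hl => hd j (Finset.mem_insert_of_mem hj) l (Finset.mem_insert_of_mem hl), ?_⟩
    refine Multiset.disjoint_left.2 fun {a} ha ha' => ?_
    obtain ⟨j, hj, haj⟩ := Multiset.mem_sum.1 ha'
    obtain rfl := hd i (Finset.mem_insert_self _ _) j (Finset.mem_insert_of_mem hj) a ha haj
    exact hi hj

theorem nodup_sum_singleton [Fintype ι] {f : ι → α} (hf : Function.Injective f) :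
    (∑ i, ({f i} : Multiset α)).Nodup :=
  nodup_sum (fun _ _ => Multiset.nodup_singleton _) fun _ _ _ _ _ ha ha' =>
    hf ((Multiset.mem_singleton.1 ha).symm.trans (Multiset.mem_singleton.1 ha'))

theorem mem_sum_singleton [Fintype ι] {f : ι → α} {a : α} :
    a ∈ ∑ i, ({f i} : Multiset α) ↔ ∃ i, a = f i := by
  simp [Multiset.mem_sum]

theorem map_sum_singleton {β : Type*} (s : Finset ι) (f : ι → α) (g : α → β) :
    (∑ i ∈ s, ({f i} : Multiset α)).map g = ∑ i ∈ s, {g (f i)} := by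
  rw [← Multiset.coe_mapAddMonoidHom, map_sum]
  simp

theorem countP_sum (q : α → Prop) [DecidablePred q] (s : Finset ι) (f : ι → Multiset α) :
    (∑ i ∈ s, f i).countP q = ∑ i ∈ s, (f i).countP q :=
  map_sum (Multiset.countPAddMonoidHom q) f s

theorem countP_singleton (q : α → Prop) [DecidablePred q] (a : α) :
    ({a} : Multiset α).countP q = if q a then 1 else 0 := by
  rw [← Multiset.cons_zero, Multiset.countP_cons, Multiset.countP_zero, zero_add]

end Multisets

section Greedy

variable {V X : Type*} {G : SimpleGraph V} {k b : ℕ} {att : X → Finset V} {rel : SimpleGraph X}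
  {B R : Finset V} {s : Finset X} {φ : X → V}

/-- Every set of at most `k` vertices has a common neighbour outside any set of fewer than `b`
vertices: the only consequence of the minimum degree condition that the gadgets need. -/
def HasCommonNeighbors (G : SimpleGraph V) (k b : ℕ) : Prop :=
  ∀ S B : Finset V, S.card ≤ k → B.card < b → ∃ w, w ∉ B ∧ ∀ s ∈ S, G.Adj s w

/-- On `s`, the map `φ` places new vertices of a gadget outside the forbidden set `B`, each joined
to its prescribed roots `att x` and, following the pattern `rel`, to other new vertices. -/
structure IsRootedEmbedding (G : SimpleGraph V) (att : X → Finset V) (rel : SimpleGraph X)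
    (B : Finset V) (s : Finset X) (φ : X → V) : Prop where
  injOn : Set.InjOn φ s
  notMem : ∀ x ∈ s, φ x ∉ B
  adj_root : ∀ x ∈ s, ∀ v ∈ att x, G.Adj v (φ x)
  adj : ∀ x ∈ s, ∀ y ∈ s, rel.Adj x y → G.Adj (φ x) (φ y)

theorem IsRootedEmbedding.insert (h : IsRootedEmbedding G att rel B s φ) {x : X} {w : V}
    (hx : x ∉ s) (hwB : w ∉ B) (hws : ∀ y ∈ s, φ y ≠ w) (hroot : ∀ v ∈ att x, G.Adj v w)
    (hrel : ∀ y, rel.Adj x y → G.Adj (φ y) w) :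
    IsRootedEmbedding G att rel B (insert x s) (Function.update φ x w) := by
  have hs_eq : ∀ y ∈ s, Function.update φ x w y = φ y := fun y hy =>
    Function.update_of_ne (ne_of_mem_of_not_mem hy hx) ..
  refine ⟨?_, ?_, ?_, ?_⟩
  · have hinj := h.injOn
    simp only [Set.InjOn, SetLike.mem_coe] at hinj ⊢
    grind
  · grind [h.notMem]
  · grind [h.adj_root]
  · grind [h.adj, rel.adj_comm, G.adj_comm, rel.irrefl]

theorem HasCommonNeighbors.exists_isRootedEmbedding [Fintype X] [rel.LocallyFinite]
    (hG : HasCommonNeighbors G k b) (hdeg : ∀ x, (att x).card + rel.degree x ≤ k)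
    (hB : B.card + Fintype.card X ≤ b) :
    ∃ φ : X → V, IsRootedEmbedding G att rel B Finset.univ φ := by
  suffices H : ∀ s : Finset X, ∃ φ, IsRootedEmbedding G att rel B s φ from H _
  intro s
  induction s using Finset.induction_on with
  | empty =>
    have hV : IsEmpty X ∨ Nonempty V := (isEmpty_or_nonempty X).imp_right fun ⟨x⟩ =>
      ⟨(hG ∅ B (by simp) (by have := Fintype.card_pos_iff.2 ⟨x⟩; omega)).choose⟩
    obtain ⟨φ⟩ : Nonempty (X → V) := by rcases hV with hX | hV <;> infer_instance
    exact ⟨φ, by simp, by simp, by simp, by simp⟩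
  | insert x s hx ih =>
    obtain ⟨φ, hφ⟩ := ih
    have hcard : (att x ∪ (rel.neighborFinset x).image φ).card ≤ k :=
      (Finset.card_union_le _ _).trans
        ((Nat.add_le_add_left Finset.card_image_le _).trans (by simpa using hdeg x))
    have hused : (B ∪ s.image φ).card < b := by
      have h₁ := Finset.card_union_le B (s.image φ)
      have h₂ : (s.image φ).card ≤ s.card := Finset.card_image_le
      have h₃ : s.card < Fintype.card X := Finset.card_lt_univ_of_notMem hx
      omega
    obtain ⟨w, hw, hadj⟩ := hG _ _ hcard hused
    refine ⟨_, hφ.insert (w := w) hx (fun h => hw (Finset.mem_union_left _ h)) (fun y hy h => hw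
      (Finset.mem_union_right _ (h ▸ Finset.mem_image_of_mem φ hy)))
      (fun v hv => hadj v (Finset.mem_union_left _ hv)) fun y hy => hadj _ ?_⟩
    exact Finset.mem_union_right _ (Finset.mem_image_of_mem φ (by simpa using hy))

/-- The edges that a rooted embedding `φ` with attachments `att` and pattern `rel` provides. -/
def newEdges (att : X → Finset V) (rel : SimpleGraph X) (φ : X → V) : Set (Sym2 V) :=
  {e | (∃ x, ∃ v ∈ att x, e = s(v, φ x)) ∨ ∃ x y, rel.Adj x y ∧ e = s(φ x, φ y)}

theorem mk_root_mem_newEdges {x : X} {v : V} (hv : v ∈ att x) :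
    s(v, φ x) ∈ newEdges att rel φ :=
  Or.inl ⟨x, v, hv, rfl⟩

theorem mk_mem_newEdges {x y : X} (h : rel.Adj x y) : s(φ x, φ y) ∈ newEdges att rel φ :=
  Or.inr ⟨x, y, h, rfl⟩

/-- `T` is a set of edges of `G` on the vertices in `R ∪ N`, each of which has an end in `N`: here
`R` is the set of roots of a gadget, and `N` the set of its new vertices. -/
structure Fresh (G : SimpleGraph V) (R N : Finset V) (T : Multiset (Sym2 V)) : Prop where
  nodup : T.Nodup
  mem_edgeSet : ∀ e ∈ T, e ∈ G.edgeSet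
  exists_new : ∀ e ∈ T, ∃ w ∈ e, w ∈ N
  subset : ∀ e ∈ T, ∀ w ∈ e, w ∈ R ∨ w ∈ N

theorem Fresh.zero (G : SimpleGraph V) (R N : Finset V) : Fresh G R N 0 :=
  ⟨Multiset.nodup_zero, by simp, by simp, by simp⟩

theorem Fresh.mono_roots {N R' : Finset V} {T : Multiset (Sym2 V)} (h : Fresh G R N T)
    (hR : R ⊆ R') : Fresh G R' N T :=
  { h with subset := fun e he w hw => (h.subset e he w hw).imp_left (@hR w) }

theorem Fresh.add {N₁ N₂ : Finset V} {T₁ T₂ : Multiset (Sym2 V)} (h₁ : Fresh G R N₁ T₁)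
    (h₂ : Fresh G (R ∪ N₁) N₂ T₂) (hd : Disjoint N₂ (R ∪ N₁)) :
    Fresh G R (N₁ ∪ N₂) (T₁ + T₂) where
  nodup := by
    refine Multiset.nodup_add.2 ⟨h₁.nodup, h₂.nodup, Multiset.disjoint_left.2 fun he he' => ?_⟩
    obtain ⟨w, hw, hwN⟩ := h₂.exists_new _ he'
    exact Finset.disjoint_left.1 hd hwN (Finset.mem_union.2 (h₁.subset _ he w hw))
  mem_edgeSet e he := (Multiset.mem_add.1 he).elim (h₁.mem_edgeSet e) (h₂.mem_edgeSet e)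
  exists_new e he := by
    rcases Multiset.mem_add.1 he with he | he
    · obtain ⟨w, hw, hN⟩ := h₁.exists_new e he
      exact ⟨w, hw, Finset.mem_union_left _ hN⟩
    · obtain ⟨w, hw, hN⟩ := h₂.exists_new e he
      exact ⟨w, hw, Finset.mem_union_right _ hN⟩
  subset e he w hw := by
    rw [Finset.mem_union, ← or_assoc]
    rcases Multiset.mem_add.1 he with he | he
    · exact Or.inl (h₁.subset e he w hw)
    · exact (h₂.subset e he w hw).imp_left Finset.mem_union.1

theorem IsRootedEmbedding.fresh [Fintype X] (h : IsRootedEmbedding G att rel B Finset.univ φ)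
    (hatt : ∀ x, att x ⊆ R) {T : Multiset (Sym2 V)} (hT : T.Nodup)
    (hTφ : ∀ e ∈ T, e ∈ newEdges att rel φ) : Fresh G R (Finset.univ.image φ) T := by
  have hφ : ∀ x, φ x ∈ Finset.univ.image φ := fun x => Finset.mem_image_of_mem _ (Finset.mem_univ x)
  refine ⟨hT, fun e he => ?_, fun e he => ?_, fun e he w hw => ?_⟩ <;>
    obtain ⟨x, v, hv, rfl⟩ | ⟨x, y, hxy, rfl⟩ := hTφ e he
  · exact h.adj_root x (Finset.mem_univ x) v hv
  · exact h.adj x (Finset.mem_univ x) y (Finset.mem_univ y) hxy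
  · exact ⟨φ x, Sym2.mem_mk_right _ _, hφ x⟩
  · exact ⟨φ x, Sym2.mem_mk_left _ _, hφ x⟩
  · rcases Sym2.mem_iff.1 hw with rfl | rfl
    exacts [Or.inl (hatt x hv), Or.inr (hφ x)]
  · rcases Sym2.mem_iff.1 hw with rfl | rfl
    exacts [Or.inr (hφ x), Or.inr (hφ y)]

end Greedy

section Convertible

variable {W V : Type*} [Fintype W] {F : SimpleGraph W} {G : SimpleGraph V} {b k k₁ k₂ : ℕ}
  {R R' : Finset V} {P Q P₁ P₂ Q₁ Q₂ : Multiset (Sym2 V)}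

/-- With the help of at most `k` new vertices, there is a set `T` of new edges at the roots `R` such
that `Φ T`. The new vertices avoid any given set `B`, as long as its size leaves room for them in
the bound `b`. -/
def HasFreshEdges (G : SimpleGraph V) (b : ℕ) (R : Finset V) (k : ℕ)
    (Φ : Multiset (Sym2 V) → Prop) : Prop :=
  ∀ B : Finset V, R ⊆ B → B.card + k ≤ b → ∃ (N : Finset V) (T : Multiset (Sym2 V)),
    Disjoint N B ∧ N.card ≤ k ∧ Fresh G R N T ∧ Φ T

/-- The edge multisets `P` and `Q` on the roots `R` can be exchanged: with the help of at most `k`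
new vertices, there are new edges `T` such that both `T + P` and `T + Q` decompose. -/
def Convertible (F : SimpleGraph W) (G : SimpleGraph V) (b : ℕ) (R : Finset V) (k : ℕ)
    (P Q : Multiset (Sym2 V)) : Prop :=
  HasFreshEdges G b R k fun T => T + P ∈ decomposable F V ∧ T + Q ∈ decomposable F V

namespace Convertible

theorem of_decomposable (hP : P ∈ decomposable F V) (hQ : Q ∈ decomposable F V) :
    Convertible F G b R 0 P Q := fun _ _ _ =>
  ⟨∅, 0, by simp, by simp, Fresh.zero _ _ _, by rwa [zero_add], by rwa [zero_add]⟩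

theorem symm (h : Convertible F G b R k P Q) : Convertible F G b R k Q P := fun B hB hk =>
  let ⟨N, T, hd, hN, hT, hP, hQ⟩ := h B hB hk
  ⟨N, T, hd, hN, hT, hQ, hP⟩

theorem mono (h : Convertible F G b R k₁ P Q) (hR : R ⊆ R') (hk : k₁ ≤ k₂) :
    Convertible F G b R' k₂ P Q := fun B hB hB' =>
  let ⟨N, T, hd, hN, hT, hPQ⟩ := h B (hR.trans hB) ((Nat.add_le_add_left hk _).trans hB')
  ⟨N, T, hd, hN.trans hk, hT.mono_roots hR, hPQ⟩

/-- A catalyst `I`, present before and after the exchange, becomes part of the new edges. -/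
theorem of_fresh
    (h : ∀ B : Finset V, R ⊆ B → B.card + (k₁ + k₂) ≤ b → ∃ (N : Finset V) (I : Multiset (Sym2 V)),
      Disjoint N B ∧ N.card ≤ k₁ ∧ Fresh G R N I ∧
        Convertible F G b (R ∪ N) k₂ (P + I) (Q + I)) :
    Convertible F G b R (k₁ + k₂) P Q := fun B hB hk => by
  obtain ⟨N₁, I, hd₁, hN₁, hI, h⟩ := h B hB hk
  have hunion : R ∪ N₁ ⊆ B ∪ N₁ := Finset.union_subset_union_left hB
  obtain ⟨N₂, T, hd₂, hN₂, hT, hP, hQ⟩ := h (B ∪ N₁) hunion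
    ((Nat.add_le_add_right (Finset.card_union_le _ _) _).trans (by omega))
  refine ⟨N₁ ∪ N₂, I + T, Finset.disjoint_union_left.2
    ⟨hd₁, hd₂.mono_right Finset.subset_union_left⟩, (Finset.card_union_le _ _).trans (by omega),
    hI.add hT (hd₂.mono_right hunion), ?_, ?_⟩
  all_goals rwa [add_comm I, add_assoc, add_comm I]

theorem of_isRootedEmbedding {X : Type*} [Fintype X] {d : ℕ} (hG : HasCommonNeighbors G d b)
    (att : X → Finset V) (rel : SimpleGraph X) [rel.LocallyFinite]
    (hdeg : ∀ x, (att x).card + rel.degree x ≤ d) (hatt : ∀ x, att x ⊆ R) (hX : Fintype.card X ≤ k₁)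
    (h : ∀ φ : X → V, Function.Injective φ → (∀ x, φ x ∉ R) → ∃ I : Multiset (Sym2 V), I.Nodup ∧
      (∀ e ∈ I, e ∈ newEdges att rel φ) ∧
        Convertible F G b (R ∪ Finset.univ.image φ) k₂ (P + I) (Q + I)) :
    Convertible F G b R (k₁ + k₂) P Q := by
  refine of_fresh fun B hB hk => ?_
  obtain ⟨φ, hφ⟩ := hG.exists_isRootedEmbedding (B := B) hdeg (by omega)
  have hφB : ∀ x, φ x ∉ B := fun x => hφ.notMem x (Finset.mem_univ x)
  obtain ⟨I, hI, hIφ, hconv⟩ := h φ (by simpa [Set.injOn_univ] using hφ.injOn)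
    fun x hx => hφB x (hB hx)
  refine ⟨Finset.univ.image φ, I, ?_, Finset.card_image_le.trans hX, hφ.fresh hatt hI hIφ, hconv⟩
  simpa [Finset.disjoint_left] using hφB

theorem add (h₁ : Convertible F G b R k₁ P₁ Q₁) (h₂ : Convertible F G b R k₂ P₂ Q₂) :
    Convertible F G b R (k₁ + k₂) (P₁ + P₂) (Q₁ + Q₂) := fun B hB hk => by
  obtain ⟨N₁, T₁, hd₁, hN₁, hT₁, hP₁, hQ₁⟩ := h₁ B hB (by omega)
  have hunion : R ∪ N₁ ⊆ B ∪ N₁ := Finset.union_subset_union_left hB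
  obtain ⟨N₂, T₂, hd₂, hN₂, hT₂, hP₂, hQ₂⟩ := h₂ (B ∪ N₁) (hB.trans Finset.subset_union_left)
    ((Nat.add_le_add_right (Finset.card_union_le _ _) _).trans (by omega))
  refine ⟨N₁ ∪ N₂, T₁ + T₂, Finset.disjoint_union_left.2
    ⟨hd₁, hd₂.mono_right Finset.subset_union_left⟩, (Finset.card_union_le _ _).trans (by omega),
    hT₁.add (hT₂.mono_roots Finset.subset_union_left) (hd₂.mono_right hunion), ?_, ?_⟩
  · rw [add_add_add_comm]; exact add_mem hP₁ hP₂
  · rw [add_add_add_comm]; exact add_mem hQ₁ hQ₂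

theorem sum {ι : Type*} (s : Finset ι) {k : ι → ℕ} {P Q : ι → Multiset (Sym2 V)}
    (h : ∀ i ∈ s, Convertible F G b R (k i) (P i) (Q i)) :
    Convertible F G b R (∑ i ∈ s, k i) (∑ i ∈ s, P i) (∑ i ∈ s, Q i) := by
  induction s using Finset.induction_on with
  | empty => exact of_decomposable (zero_mem _) (zero_mem _)
  | insert i s hi ih =>
    simp only [Finset.sum_insert hi]
    exact (h i (Finset.mem_insert_self _ _)).add
      (ih fun j hj => h j (Finset.mem_insert_of_mem hj))

theorem add_decomposable_left (h : Convertible F G b R k P Q) {Y : Multiset (Sym2 V)}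
    (hY : Y ∈ decomposable F V) : Convertible F G b R k (P + Y) Q := by
  simpa using h.add (of_decomposable hY (zero_mem _))

end Convertible

end Convertible

section Cones

variable {ι κ V U : Type*} [Fintype ι] [Fintype κ] {H : SimpleGraph ι} {v : V} {ν : ι → V}

/-- The edges of a star with centre `v` and leaves `ν i`. -/
noncomputable def starEdges (v : V) (ν : ι → V) : Multiset (Sym2 V) :=
  ∑ i, {s(v, ν i)}

theorem mem_starEdges {e : Sym2 V} : e ∈ starEdges v ν ↔ ∃ i, e = s(v, ν i) :=
  mem_sum_singleton

theorem starEdges_nodup (hν : Function.Injective ν) : (starEdges v ν).Nodup :=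
  nodup_sum_singleton fun _ _ h => hν (Sym2.congr_right.1 h)

theorem map_starEdges (g : V → U) :
    (starEdges v ν).map (Sym2.map g) = starEdges (g v) (g ∘ ν) :=
  map_sum_singleton _ _ _

theorem starEdges_comp_equiv (e : κ ≃ ι) : starEdges v (ν ∘ e) = starEdges v ν :=
  e.sum_comp fun i => ({s(v, ν i)} : Multiset (Sym2 V))

/-- The edges of a star with centre `v` together with a copy of `H` on its leaves. In a copy of `F`,
these are the edges on the closed neighbourhood of a vertex, if `H` is induced by its neighbours. -/
noncomputable def coneEdges (H : SimpleGraph ι) (v : V) (ν : ι → V) : Multiset (Sym2 V) :=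
  starEdges v ν + copyEdges H ν

theorem mem_coneEdges {e : Sym2 V} :
    e ∈ coneEdges H v ν ↔ (∃ i, e = s(v, ν i)) ∨ ∃ i j, H.Adj i j ∧ e = s(ν i, ν j) := by
  rw [coneEdges, Multiset.mem_add, mem_starEdges, mem_copyEdges]

theorem coneEdges_nodup (hν : Function.Injective ν) (hv : ∀ i, ν i ≠ v) :
    (coneEdges H v ν).Nodup := by
  refine Multiset.nodup_add.2 ⟨starEdges_nodup hν, copyEdges_nodup H hν,
    Multiset.disjoint_left.2 fun {e} he he' => ?_⟩
  obtain ⟨i, rfl⟩ := mem_starEdges.1 he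
  obtain ⟨a, b, -, hab⟩ := mem_copyEdges.1 he'
  rcases Sym2.mem_iff.1 (hab ▸ Sym2.mem_mk_left v (ν i)) with h | h
  exacts [hv a h.symm, hv b h.symm]

theorem map_coneEdges (g : V → U) :
    (coneEdges H v ν).map (Sym2.map g) = coneEdges H (g v) (g ∘ ν) := by
  rw [coneEdges, Multiset.map_add, map_starEdges, map_copyEdges, coneEdges]

theorem coneEdges_iso {H' : SimpleGraph κ} (e : H' ≃g H) :
    coneEdges H' v (ν ∘ e) = coneEdges H v ν := by
  rw [coneEdges, copyEdges_iso, coneEdges, ← starEdges_comp_equiv e.toEquiv]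
  rfl

end Cones

section ConePlacement

variable {W V : Type*} {F : SimpleGraph W} {x : W} {u u' : V} {ν : F.neighborSet x → V}
  {φ : {w // w ≠ x ∧ ¬F.Adj x w} → V}

/-- The placement of `F` that puts `x` at `u`, its neighbours at `ν` and the other vertices at
`φ`. -/
noncomputable def conePlacement (u : V) (ν : F.neighborSet x → V)
    (φ : {w // w ≠ x ∧ ¬F.Adj x w} → V) (w : W) : V :=
  if hx : w = x then u else if hw : F.Adj x w then ν ⟨w, hw⟩ else φ ⟨w, hx, hw⟩

theorem conePlacement_self : conePlacement u ν φ x = u :=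
  dif_pos rfl

theorem conePlacement_neighbor (n : F.neighborSet x) : conePlacement u ν φ n = ν n :=
  (dif_neg n.2.ne').trans (dif_pos n.2)

theorem conePlacement_outer (w : {w // w ≠ x ∧ ¬F.Adj x w}) : conePlacement u ν φ w = φ w :=
  (dif_neg w.2.1).trans (dif_neg w.2.2)

theorem conePlacement_injective (hν : Function.Injective ν) (hφ : Function.Injective φ)
    (hu : ∀ n, ν n ≠ u) (hφu : ∀ w, φ w ≠ u) (hφν : ∀ w n, φ w ≠ ν n) :
    Function.Injective (conePlacement u ν φ) := by
  intro a c hac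
  unfold conePlacement at hac
  split_ifs at hac with ha hc hc hc hc hc
  all_goals grind [Function.Injective]

variable [Fintype W]

/-- The edges of `F` that have an end outside the closed neighbourhood of `x`. -/
noncomputable def outerEdges (F : SimpleGraph W) (x : W) : Finset (Sym2 W) :=
  F.edgeFinset.filter fun e => ∃ w ∈ e, w ≠ x ∧ ¬F.Adj x w

theorem edgeFinset_eq_cone_add_outer (F : SimpleGraph W) (x : W) :
    F.edgeFinset.val =
      coneEdges (F.induce (F.neighborSet x)) x (fun n => (n : W)) + (outerEdges F x).val := by
  have hval : Function.Injective fun n : F.neighborSet x => (n : W) := Subtype.val_injective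
  have hcone : (F.edgeFinset.filter fun e => ¬∃ w ∈ e, w ≠ x ∧ ¬F.Adj x w).val =
      coneEdges (F.induce (F.neighborSet x)) x (fun n => (n : W)) := by
    refine ((Finset.nodup _).ext (coneEdges_nodup hval fun n => n.2.ne')).2 fun e => ?_
    induction e with
    | _ a b =>
      rw [mem_coneEdges, Finset.mem_val, Finset.mem_filter, SimpleGraph.mem_edgeFinset,
        SimpleGraph.mem_edgeSet]
      simp only [Sym2.mem_iff, not_exists, not_and, not_not, ne_eq, Subtype.exists,
        SimpleGraph.mem_neighborSet, SimpleGraph.comap_adj, Function.Embedding.subtype_apply,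
        Sym2.eq_iff]
      grind [F.adj_comm, F.irrefl]
  rw [← hcone, add_comm, outerEdges]
  exact (Multiset.filter_add_not _ _).symm

theorem copyEdges_conePlacement :
    copyEdges F (conePlacement u ν φ) = coneEdges (F.induce (F.neighborSet x)) u ν +
      (outerEdges F x).val.map (Sym2.map (conePlacement u ν φ)) := by
  rw [copyEdges, edgeFinset_eq_cone_add_outer F x, Multiset.map_add, map_coneEdges,
    conePlacement_self]
  exact congrArg (coneEdges _ u · + _) (funext conePlacement_neighbor)

theorem exists_eq_of_mem_outerEdges {e : Sym2 W} (he : e ∈ outerEdges F x) :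
    ∃ w : {w // w ≠ x ∧ ¬F.Adj x w}, ∃ y, y ≠ x ∧ F.Adj w y ∧ e = s(↑w, y) := by
  obtain ⟨heF, w, hw, hwx⟩ := Finset.mem_filter.1 he
  obtain ⟨y, rfl⟩ := hw
  rw [SimpleGraph.mem_edgeFinset, SimpleGraph.mem_edgeSet] at heF
  exact ⟨⟨w, hwx⟩, y, fun h => hwx.2 (h ▸ heF.symm), heF, rfl⟩

theorem map_outerEdges_congr :
    (outerEdges F x).val.map (Sym2.map (conePlacement u ν φ)) =
      (outerEdges F x).val.map (Sym2.map (conePlacement u' ν φ)) := by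
  refine Multiset.map_congr rfl fun e he => ?_
  obtain ⟨w, y, hy, -, rfl⟩ := exists_eq_of_mem_outerEdges he
  simp only [Sym2.map_mk, conePlacement, dif_neg w.2.1, dif_neg hy]

theorem map_outerEdges_mem_newEdges {att : {w // w ≠ x ∧ ¬F.Adj x w} → Finset V}
    (hatt : ∀ w, ∀ n : F.neighborSet x, F.Adj w.1 n → ν n ∈ att w) :
    ∀ e ∈ (outerEdges F x).val.map (Sym2.map (conePlacement u ν φ)),
      e ∈ newEdges att (F.comap Subtype.val) φ := by
  intro e he
  obtain ⟨d, hd, rfl⟩ := Multiset.mem_map.1 he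
  obtain ⟨w, y, hyx, hwy, rfl⟩ := exists_eq_of_mem_outerEdges hd
  rw [Sym2.map_mk, conePlacement_outer]
  by_cases hy : F.Adj x y
  · rw [conePlacement_neighbor ⟨y, hy⟩, Sym2.eq_swap]
    exact mk_root_mem_newEdges (hatt w ⟨y, hy⟩ hwy)
  · rw [conePlacement_outer ⟨y, hyx, hy⟩]
    exact mk_mem_newEdges (F.comap_adj.2 hwy)

end ConePlacement

section Stars

variable {W V : Type*} [Fintype W] {F : SimpleGraph W} {G : SimpleGraph V} {b r : ℕ}
  {R : Finset V} {v p : V}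

theorem convertible_cone (hF : F.IsRegularOfDegree r) (hG : HasCommonNeighbors G (3 * r) b)
    {x : W} {ν : F.neighborSet x → V} (hν : Function.Injective ν) (hv : ∀ n, ν n ≠ v)
    (hp : ∀ n, ν n ≠ p) (hvR : v ∈ R) (hpR : p ∈ R) (hνR : ∀ n, ν n ∈ R) :
    Convertible F G b R (Fintype.card W) (coneEdges (F.induce (F.neighborSet x)) v ν)
      (coneEdges (F.induce (F.neighborSet x)) p ν) := by
  let att (w : {w // w ≠ x ∧ ¬F.Adj x w}) : Finset V :=
    (Finset.univ.filter fun n : F.neighborSet x => F.Adj w n).image ν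
  let rel : SimpleGraph {w // w ≠ x ∧ ¬F.Adj x w} := F.comap Subtype.val
  have hatt : ∀ w, (att w).card ≤ r := fun w => by
    rw [← hF.degree_eq w, ← SimpleGraph.card_neighborFinset_eq_degree]
    refine Finset.card_image_le.trans (Finset.card_le_card_of_injOn Subtype.val (fun n hn => ?_)
      Subtype.val_injective.injOn)
    simpa using hn
  have hrel : ∀ w, rel.degree w ≤ r := fun w => (hF.degree_eq (w : W)) ▸
    (SimpleGraph.Embedding.comap (Function.Embedding.subtype _) F).toCopy.degree_le w
  have hdeg : ∀ w, (att w).card + rel.degree w ≤ 3 * r := fun w => by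
    have := hatt w
    have := hrel w
    omega
  refine Convertible.of_isRootedEmbedding (k₂ := 0) hG att rel hdeg (fun w => by grind)
    (Fintype.card_subtype_le _) fun φ hφ hφR => ?_
  have hφne : ∀ {u}, u ∈ R → ∀ w, φ w ≠ u := fun hu w h => hφR w (h ▸ hu)
  have hinj : ∀ u ∈ R, (∀ n, ν n ≠ u) → Function.Injective (conePlacement u ν φ) :=
    fun u hu hνu => conePlacement_injective hν hφ hνu (hφne hu) fun w n => hφne (hνR n) w
  refine ⟨(outerEdges F x).val.map (Sym2.map (conePlacement v ν φ)),
    (outerEdges F x).nodup.map (Sym2.map.injective (hinj v hvR hv)),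
    map_outerEdges_mem_newEdges fun w n hn => by grind, .of_decomposable ?_ ?_⟩
  · rw [← copyEdges_conePlacement]
    exact copyEdges_mem_decomposable F (hinj v hvR hv)
  · rw [map_outerEdges_congr (u' := p), ← copyEdges_conePlacement]
    exact copyEdges_mem_decomposable F (hinj p hpR hp)

theorem convertible_coneEdges {ι : Type*} [Fintype ι] {H : SimpleGraph ι}
    (hF : F.IsRegularOfDegree r) (hG : HasCommonNeighbors G (3 * r) b) {x : W}
    (e : H ≃g F.induce (F.neighborSet x)) {ν : ι → V} (hν : Function.Injective ν)
    (hv : ∀ i, ν i ≠ v) (hp : ∀ i, ν i ≠ p) (hvR : v ∈ R) (hpR : p ∈ R) (hνR : ∀ i, ν i ∈ R) :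
    Convertible F G b R (Fintype.card W) (coneEdges H v ν) (coneEdges H p ν) := by
  have h := convertible_cone (ν := ν ∘ e.symm) hF hG (hν.comp e.symm.injective) (fun n => hv _)
    (fun n => hp _) hvR hpR fun n => hνR _
  rwa [← coneEdges_iso e, ← coneEdges_iso e, Function.comp_assoc, e.symm_comp_self] at h

section Grid

variable {κ : Type*} {H : SimpleGraph (Option κ)} {g : Option κ → Option κ → V}

/-- The grid whose column `none` consists of the leaves `z`, and whose other entries are `φ`. -/
def gridPlacement (z : Option κ → V) (φ : Option κ × κ → V) (i j : Option κ) : V :=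
  j.elim (z i) fun j => φ (i, j)

theorem gridPlacement_injective2 {z : Option κ → V} {φ : Option κ × κ → V}
    (hz : Function.Injective z) (hφ : Function.Injective φ) (hφz : ∀ x i, φ x ≠ z i) :
    Function.Injective2 (gridPlacement z φ) := by
  intro i i' j j' h
  unfold gridPlacement at h
  cases j <;> cases j' <;> grind [Function.Injective]

/-- The roots to which the entries of the grid outside the column `none` are attached. -/
noncomputable def gridRoots (H : SimpleGraph (Option κ)) (v p : V) (z : Option κ → V)
    (x : Option κ × κ) : Finset V :=
  {v, p} ∪ if H.Adj none (some x.2) then {z x.1} else ∅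

theorem card_gridRoots_le (z : Option κ → V) (x : Option κ × κ) :
    (gridRoots H v p z x).card ≤ 3 := by
  unfold gridRoots
  split_ifs
  · exact (Finset.card_union_le _ _).trans (Nat.add_le_add_right Finset.card_le_two 1)
  · rw [Finset.union_empty]
    exact Finset.card_le_two.trans (by norm_num)

variable [Fintype κ]

/-- The catalyst that moves a star from `v` to `p`. Its leaves form the column `none` of the grid
`g`; the catalyst joins the other columns completely to `v` and `p`, and puts a copy of `H` on every
row and on every column but `none`. -/
noncomputable def gridEdges (H : SimpleGraph (Option κ)) (v p : V) (g : Option κ → Option κ → V) :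
    Multiset (Sym2 V) :=
  ∑ j : κ, (coneEdges H v (fun i => g i (some j)) + starEdges p (fun i => g i (some j))) +
    ∑ i, copyEdges H (g i)

theorem mem_gridEdges {e : Sym2 V} :
    e ∈ gridEdges H v p g ↔
      (∃ j, (∃ i, e = s(v, g i (some j))) ∨ (∃ i i', H.Adj i i' ∧
        e = s(g i (some j), g i' (some j))) ∨ ∃ i, e = s(p, g i (some j))) ∨
      ∃ i j j', H.Adj j j' ∧ e = s(g i j, g i j') := by
  simp only [gridEdges, Multiset.mem_add, Multiset.mem_sum, Finset.mem_univ, true_and,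
    mem_coneEdges, mem_starEdges, mem_copyEdges, or_assoc]

theorem gridEdges_comm : gridEdges H v p g = gridEdges H p v g := by
  unfold gridEdges coneEdges
  exact congrArg (· + _) (Finset.sum_congr rfl fun _ _ => by abel)

theorem starEdges_add_gridEdges :
    starEdges v (fun i => g i none) + gridEdges H v p g =
      ∑ i, coneEdges H v (g i) + ∑ j, coneEdges H p (fun i => g i (some j)) := by
  have h : ∑ i, starEdges v (g i) =
      starEdges v (fun i => g i none) + ∑ j, starEdges v (fun i => g i (some j)) := by
    simp only [starEdges]
    rw [Finset.sum_comm, Fintype.sum_option]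
  simp only [gridEdges, coneEdges, Finset.sum_add_distrib, h]
  abel

theorem gridEdges_nodup (hg : Function.Injective2 g) (hv : ∀ i j, g i j ≠ v)
    (hp : ∀ i j, g i j ≠ p) (hvp : v ≠ p) : (gridEdges H v p g).Nodup := by
  have hrow : ∀ i, Function.Injective (g i) := fun i => hg.right i
  have hcol : ∀ j, Function.Injective fun i => g i j := fun j => hg.left j
  unfold gridEdges
  rw [Multiset.nodup_add]
  refine ⟨nodup_sum (fun j _ => Multiset.nodup_add.2 ⟨coneEdges_nodup (hcol _) fun i => hv i _,
    starEdges_nodup (hcol _), ?_⟩) ?_, nodup_sum (fun i _ => copyEdges_nodup H (hrow i)) ?_, ?_⟩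
  all_goals simp only [Multiset.disjoint_left, Multiset.mem_sum, Multiset.mem_add, mem_coneEdges,
    mem_starEdges, mem_copyEdges]
  · rintro e (⟨i, rfl⟩ | ⟨i, i', -, rfl⟩) ⟨i'', h⟩ <;> grind
  · rintro j - j' - e ((⟨i, rfl⟩ | ⟨i, i', -, rfl⟩) | ⟨i, rfl⟩)
      ((⟨l, h⟩ | ⟨l, l', -, h⟩) | ⟨l, h⟩) <;> grind [Function.Injective2]
  · rintro i - i' - e ⟨j, j', -, rfl⟩ ⟨l, l', -, h⟩
    grind [Function.Injective2]
  · rintro e ⟨j, -, (⟨i, rfl⟩ | ⟨i, i', -, rfl⟩) | ⟨i, rfl⟩⟩ ⟨l, -, a, c, hac, h⟩ <;>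
      have := hac.ne <;> grind [Function.Injective2]

theorem gridEdges_mem_newEdges {z : Option κ → V} {φ : Option κ × κ → V} :
    ∀ e ∈ gridEdges H v p (gridPlacement z φ),
      e ∈ newEdges (gridRoots H v p z) (H □ H.comap some) φ := by
  intro e he
  rcases mem_gridEdges.1 he with ⟨j, ⟨i, rfl⟩ | ⟨i, i', h, rfl⟩ | ⟨i, rfl⟩⟩ | ⟨i, j, j', h, rfl⟩
  · exact mk_root_mem_newEdges (by simp [gridRoots])
  · exact mk_mem_newEdges (SimpleGraph.boxProd_adj.2 (Or.inl ⟨h, rfl⟩))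
  · exact mk_root_mem_newEdges (by simp [gridRoots])
  · cases j with
    | none =>
      cases j' with
      | none => exact (H.irrefl h).elim
      | some j' => exact mk_root_mem_newEdges (by simp [gridRoots, gridPlacement, h])
    | some j =>
      cases j' with
      | none =>
        exact Sym2.eq_swap ▸ mk_root_mem_newEdges (by simp [gridRoots, gridPlacement, h.symm])
      | some j' => exact mk_mem_newEdges (SimpleGraph.boxProd_adj.2 (Or.inr ⟨h, rfl⟩))

theorem convertible_grid (hF : F.IsRegularOfDegree r) (hG : HasCommonNeighbors G (3 * r) b)
    {x : W} (e : H ≃g F.induce (F.neighborSet x)) (hg : Function.Injective2 g)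
    (hv : ∀ i j, g i j ≠ v) (hp : ∀ i j, g i j ≠ p) (hvR : v ∈ R) (hpR : p ∈ R)
    (hgR : ∀ i j, g i j ∈ R) :
    Convertible F G b R ((2 * Fintype.card κ + 1) * Fintype.card W)
      (starEdges v (fun i => g i none) + gridEdges H v p g)
      (starEdges p (fun i => g i none) + gridEdges H v p g) := by
  -- A star at `v` and the catalyst form cones with centre `v` on the rows and centre `p` on the
  -- columns but `none`. Swapping all the centres leaves the catalyst and the star at `p`.
  have hrows := Convertible.sum Finset.univ fun i _ =>
    convertible_coneEdges hF hG e (hg.right i) (hv i) (hp i) hvR hpR (hgR i)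
  have hcols := Convertible.sum Finset.univ fun (j : κ) _ =>
    convertible_coneEdges hF hG e (hg.left (some j)) (fun i => hp i _) (fun i => hv i _) hpR hvR
      fun i => hgR i _
  rw [starEdges_add_gridEdges, gridEdges_comm, starEdges_add_gridEdges]
  refine (hrows.add hcols).mono subset_rfl (le_of_eq ?_)
  simp only [Finset.sum_const, smul_eq_mul, Finset.card_univ, Fintype.card_option]
  ring

theorem degree_boxProd_comap_lt (H : SimpleGraph (Option κ)) [(H □ H.comap some).LocallyFinite]
    (x : Option κ × κ) : (H □ H.comap some).degree x < 2 * Fintype.card κ := by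
  have h₁ := H.degree_lt_card_verts x.1
  have h₂ := (H.comap some).degree_lt_card_verts x.2
  rw [Fintype.card_option] at h₁
  rw [SimpleGraph.degree_boxProd]
  omega

end Grid

/-- The number of new vertices that suffice to move a star with `r` leaves, if `F` is an `r`-regular
graph on `f` vertices. -/
def starCost (r f : ℕ) : ℕ :=
  r * r + 2 * r * f

theorem convertible_starEdges_option {κ : Type*} [Fintype κ] [Nonempty W]
    (hF : F.IsRegularOfDegree r) (hG : HasCommonNeighbors G (3 * r) b)
    (hκ : Fintype.card (Option κ) = r) {z : Option κ → V} (hz : Function.Injective z)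
    (hv : ∀ i, z i ≠ v) (hp : ∀ i, z i ≠ p) (hvp : v ≠ p) (hvR : v ∈ R) (hpR : p ∈ R)
    (hzR : ∀ i, z i ∈ R) :
    Convertible F G b R (starCost r (Fintype.card W)) (starEdges v z) (starEdges p z) := by
  obtain ⟨x⟩ := ‹Nonempty W›
  have hN : Fintype.card (Option κ) = Fintype.card (F.neighborSet x) := by
    rw [hκ, SimpleGraph.card_neighborSet_eq_degree, hF.degree_eq x]
  let e₀ : Option κ ≃ F.neighborSet x := Fintype.equivOfCardEq hN
  let e := SimpleGraph.Iso.comap e₀ (F.induce (F.neighborSet x))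
  set H := (F.induce (F.neighborSet x)).comap e₀
  rw [Fintype.card_option] at hκ
  refine Convertible.of_isRootedEmbedding hG (gridRoots H v p z) (H □ H.comap some)
    (fun i => ?_) (fun i => ?_) ?_ fun φ hφ hφR => ?_
  · have h₁ := card_gridRoots_le (H := H) (v := v) (p := p) z i
    have h₂ := degree_boxProd_comap_lt H i
    omega
  · unfold gridRoots
    grind
  · rw [Fintype.card_prod, Fintype.card_option, hκ]
    exact Nat.mul_le_mul_left _ (by omega)
  have hg : Function.Injective2 (gridPlacement z φ) :=
    gridPlacement_injective2 hz hφ fun x i h => hφR x (h ▸ hzR i)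
  have hgR : ∀ u ∈ R, (∀ i, z i ≠ u) → ∀ i j, gridPlacement z φ i j ≠ u := fun u hu hzu i j =>
    j.rec (hzu i) fun j h => hφR _ (h ▸ hu)
  refine ⟨gridEdges H v p (gridPlacement z φ),
    gridEdges_nodup hg (hgR v hvR hv) (hgR p hpR hp) hvp, gridEdges_mem_newEdges, ?_⟩
  refine (convertible_grid hF hG e hg (hgR v hvR hv) (hgR p hpR hp)
    (Finset.mem_union_left _ hvR) (Finset.mem_union_left _ hpR) fun i j => ?_).mono subset_rfl ?_
  · cases j with
    | none => exact Finset.mem_union_left _ (hzR i)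
    | some j => exact Finset.mem_union_right _ (Finset.mem_image_of_mem φ (Finset.mem_univ (i, j)))
  · exact Nat.mul_le_mul_right _ (by omega)

theorem convertible_starEdges {ι : Type*} [Fintype ι] [Nonempty W] (hF : F.IsRegularOfDegree r)
    (hr : 0 < r) (hG : HasCommonNeighbors G (3 * r) b) (hι : Fintype.card ι = r) {z : ι → V}
    (hz : Function.Injective z) (hv : ∀ i, z i ≠ v) (hp : ∀ i, z i ≠ p) (hvp : v ≠ p)
    (hvR : v ∈ R) (hpR : p ∈ R) (hzR : ∀ i, z i ∈ R) :
    Convertible F G b R (starCost r (Fintype.card W)) (starEdges v z) (starEdges p z) := by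
  have hκ : Fintype.card (Option (Fin (r - 1))) = r := by
    rw [Fintype.card_option, Fintype.card_fin, Nat.sub_add_cancel hr]
  let e : Option (Fin (r - 1)) ≃ ι := Fintype.equivOfCardEq (hκ.trans hι.symm)
  rw [← starEdges_comp_equiv e, ← starEdges_comp_equiv (v := p) e]
  exact convertible_starEdges_option hF hG hκ (hz.comp e.injective) (fun i => hv _)
    (fun i => hp _) hvp hvR hpR fun i => hzR _

end Stars

section DegreeSums

variable {W V : Type*} [Fintype W] {F : SimpleGraph W} {r : ℕ}

theorem countP_mem_edgeFinset (F : SimpleGraph W) (w : W) :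
    F.edgeFinset.val.countP (fun e => w ∈ e) = F.degree w := by
  rw [Multiset.countP_eq_card_filter, ← Finset.filter_val, Finset.card_val,
    ← SimpleGraph.card_incidenceFinset_eq_degree, SimpleGraph.incidenceFinset_eq_filter]

theorem countP_copyEdges_apply (F : SimpleGraph W) {φ : W → V} (hφ : Function.Injective φ) (w : W) :
    (copyEdges F φ).countP (fun e => φ w ∈ e) = F.degree w := by
  rw [copyEdges, Multiset.countP_map, ← Multiset.countP_eq_card_filter, ← countP_mem_edgeFinset]
  exact Multiset.countP_congr rfl fun e _ => by simp [Sym2.mem_map, hφ.eq_iff]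

theorem dvd_countP_copyEdges (hF : ∀ w, r ∣ F.degree w) {φ : W → V} (hφ : Function.Injective φ)
    (v : V) : r ∣ (copyEdges F φ).countP (fun e => v ∈ e) := by
  by_cases hv : ∃ w, φ w = v
  · obtain ⟨w, rfl⟩ := hv
    exact countP_copyEdges_apply F hφ w ▸ hF w
  · rw [Multiset.countP_eq_zero.2]
    · exact dvd_zero _
    · rintro e he hve
      obtain ⟨a, c, -, rfl⟩ := mem_copyEdges.1 he
      rcases Sym2.mem_iff.1 hve with h | h
      exacts [hv ⟨a, h.symm⟩, hv ⟨c, h.symm⟩]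

end DegreeSums

section Matchings

variable {ι J V : Type*}

/-- The two ends of each of the edges `q j`. -/
noncomputable def ends (q : J → Sym2 V) (i : J × Bool) : V :=
  if i.2 then (Quot.out (q i.1)).2 else (Quot.out (q i.1)).1

theorem mk_ends (q : J → Sym2 V) (j : J) : s(ends q (j, false), ends q (j, true)) = q j :=
  Quot.out_eq (q j)

theorem ends_ne {q : J → Sym2 V} {j : J} (h : ¬(q j).IsDiag) :
    ends q (j, false) ≠ ends q (j, true) := by
  rwa [← mk_ends q j, Sym2.mk_isDiag_iff] at h

variable [Fintype ι] [Fintype J]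

/-- The edges that join `a i` to `c i`, for every index `i`. -/
noncomputable def matchingEdges (a c : ι → V) : Multiset (Sym2 V) :=
  ∑ i, {s(a i, c i)}

/-- The edges that join the two vertices of every pair `a (j, false), a (j, true)`. -/
noncomputable def pairEdges (a : J × Bool → V) : Multiset (Sym2 V) :=
  matchingEdges (fun j => a (j, false)) (fun j => a (j, true))

theorem mem_matchingEdges {a c : ι → V} {e : Sym2 V} :
    e ∈ matchingEdges a c ↔ ∃ i, e = s(a i, c i) :=
  mem_sum_singleton

theorem mem_pairEdges {a : J × Bool → V} {e : Sym2 V} :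
    e ∈ pairEdges a ↔ ∃ j, e = s(a (j, false), a (j, true)) :=
  mem_sum_singleton

theorem matchingEdges_nodup {a c : ι → V} (hc : Function.Injective c)
    (hac : ∀ i j, c i ≠ a j) : (matchingEdges a c).Nodup :=
  nodup_sum_singleton fun i j h => by grind [Function.Injective]

theorem pairEdges_nodup {a : J × Bool → V} (ha : Function.Injective a) : (pairEdges a).Nodup :=
  matchingEdges_nodup (fun i j h => by simpa using ha h) fun i j h => by simpa using ha h

theorem countP_pairEdges {a : J × Bool → V} (ha : ∀ j, a (j, false) ≠ a (j, true)) (v : V) :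
    (pairEdges a).countP (fun e => v ∈ e) = (Finset.univ.filter fun i => a i = v).card := by
  rw [pairEdges, matchingEdges, countP_sum, Finset.card_filter, Fintype.sum_prod_type]
  refine Finset.sum_congr rfl fun j _ => ?_
  rw [countP_singleton, Fintype.sum_bool]
  grind

theorem map_pairEdges {U : Type*} (a : J × Bool → V) (g : V → U) :
    (pairEdges a).map (Sym2.map g) = pairEdges (g ∘ a) :=
  map_sum_singleton _ _ _

theorem pairEdges_ends (q : J → Sym2 V) : pairEdges (ends q) = ∑ j, {q j} :=
  Finset.sum_congr rfl fun j _ => by rw [mk_ends]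

theorem exists_pairEdges_eq {P : Multiset (Sym2 V)} (h : Fintype.card J = Multiset.card P) :
    ∃ a : J × Bool → V, pairEdges a = P := by
  let e : J ≃ P.ToType := Fintype.equivOfCardEq (by rw [h, Multiset.card_coe])
  refine ⟨ends fun j => (e j).1, ?_⟩
  rw [pairEdges_ends, e.sum_comp fun d : P.ToType => ({d.1} : Multiset (Sym2 V))]
  conv_rhs => rw [← Multiset.map_univ_coe P]
  simp [Finset.sum]

theorem pairEdges_comp_ends {W : Type*} [Fintype W] (F : SimpleGraph W) (φ : W → V) :
    pairEdges (φ ∘ ends fun e : F.edgeSet => e.1) = copyEdges F φ := by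
  rw [← map_pairEdges, pairEdges_ends, copyEdges, ← Finset.sum_multiset_singleton F.edgeFinset,
    Finset.sum_subtype F.edgeFinset fun e => SimpleGraph.mem_edgeFinset]

theorem card_filter_ends {W : Type*} [Fintype W] (F : SimpleGraph W) (w : W) :
    (Finset.univ.filter fun i => ends (fun e : F.edgeSet => e.1) i = w).card = F.degree w := by
  rw [← countP_pairEdges fun e => ends_ne (F.not_isDiag_of_mem_edgeSet e.2)]
  exact (congrArg _ (pairEdges_comp_ends F id)).trans
    (countP_copyEdges_apply F Function.injective_id w)

end Matchings

section Exchanges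

variable {W V : Type*} [Fintype W] [Nonempty W] {F : SimpleGraph W} {G : SimpleGraph V} {b r : ℕ}
  {R : Finset V} {p : V}

/-- The number of new vertices that suffice to exchange the partners of two edges. -/
def switchCost (r f : ℕ) : ℕ :=
  r + 2 * starCost r f

theorem convertible_switch (hF : F.IsRegularOfDegree r) (hr : 0 < r)
    (hG : HasCommonNeighbors G (3 * r) b) {u v x y : V} (huR : u ∈ R) (hvR : v ∈ R) (hxR : x ∈ R)
    (hyR : y ∈ R) (huv : u ≠ v) (hux : u ≠ x) (hvx : v ≠ x) (hvy : v ≠ y) (hxy : x ≠ y) :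
    Convertible F G b R (switchCost r (Fintype.card W)) ({s(v, u)} + {s(x, y)})
      ({s(x, u)} + {s(v, y)}) := by
  refine Convertible.of_isRootedEmbedding (X := Fin (r - 1)) hG (fun _ => {v, x}) ⊥ (fun i => ?_)
    (fun _ => by grind) (by simp) fun φ hφ hφR => ?_
  · have : ({v, x} : Finset V).card ≤ 2 := Finset.card_le_two
    rw [SimpleGraph.bot_degree]
    have := i.isLt
    omega
  let leaves (t : V) (o : Option (Fin (r - 1))) : V := o.elim t φ
  have hne : ∀ {t}, t ∈ R → ∀ i, φ i ≠ t := fun ht i h => hφR i (h ▸ ht)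
  have hstar : ∀ {t s}, starEdges s (leaves t) = {s(s, t)} + starEdges s φ := Fintype.sum_option _
  have move : ∀ {t s s'}, t ∈ R → s ∈ R → s' ∈ R → t ≠ s → t ≠ s' → s ≠ s' →
      Convertible F G b (R ∪ Finset.univ.image φ) (starCost r (Fintype.card W))
        ({s(s, t)} + starEdges s φ) ({s(s', t)} + starEdges s' φ) := by
    intro t s s' ht hs hs' hts hts' hss'
    rw [← hstar, ← hstar]
    refine convertible_starEdges hF hr hG (by simp; omega) ?_ ?_ ?_ hss'
      (Finset.mem_union_left _ hs) (Finset.mem_union_left _ hs') ?_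
    · rintro (_ | i) (_ | j) h <;> grind [Function.Injective]
    all_goals rintro (_ | i) <;> grind
  refine ⟨starEdges v φ + starEdges x φ, ?_, ?_, ?_⟩
  · refine Multiset.nodup_add.2 ⟨starEdges_nodup hφ, starEdges_nodup hφ, ?_⟩
    simp only [Multiset.disjoint_left, mem_starEdges]
    rintro e ⟨i, rfl⟩ ⟨j, h⟩
    rcases Sym2.eq_iff.1 h with ⟨h, -⟩ | ⟨h, -⟩
    exacts [hvx h, hne hvR j h.symm]
  · simp only [Multiset.mem_add, mem_starEdges]
    rintro e (⟨i, rfl⟩ | ⟨i, rfl⟩) <;> exact mk_root_mem_newEdges (by simp)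
  · have h := (move huR hvR hxR huv hux hvx).add (move hyR hxR hvR hxy.symm hvy.symm hvx.symm)
    rw [two_mul]
    convert h using 1 <;> abel

theorem convertible_gather_fiber (hF : F.IsRegularOfDegree r) (hr : 0 < r)
    (hG : HasCommonNeighbors G (3 * r) b) {κ : Type*} {port : κ → V} {v : V}
    (hport : Function.Injective port) (hvR : v ∈ R) (hpR : p ∈ R) (hR : ∀ i, port i ∈ R)
    (hv : ∀ i, port i ≠ v) (hp : ∀ i, port i ≠ p) (hvp : v ≠ p) (I : Finset κ) (hI : r ∣ I.card) :
    Convertible F G b R (I.card * starCost r (Fintype.card W)) (∑ i ∈ I, {s(v, port i)})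
      (∑ i ∈ I, {s(p, port i)}) := by
  obtain ⟨q, hq⟩ := hI
  induction q generalizing I with
  | zero =>
    obtain rfl := Finset.card_eq_zero.1 hq
    simpa using Convertible.of_decomposable (zero_mem _) (zero_mem _)
  | succ q ih =>
    obtain ⟨t, htI, ht⟩ := Finset.exists_subset_card_eq (hq ▸ Nat.le_mul_of_pos_right r q.succ_pos)
    have hstar := convertible_starEdges hF hr hG ((Fintype.card_coe t).trans ht)
      (z := fun i : t => port i) (hport.comp Subtype.val_injective) (fun i => hv i) (fun i => hp i)
      hvp hvR hpR fun i => hR i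
    simp only [starEdges, Finset.sum_coe_sort t fun i => ({s(v, port i)} : Multiset (Sym2 V)),
      Finset.sum_coe_sort t fun i => ({s(p, port i)} : Multiset (Sym2 V))] at hstar
    have hcard : (I \ t).card = r * q := by
      rw [Finset.card_sdiff_of_subset htI, hq, ht, Nat.mul_succ, Nat.add_sub_cancel]
    rw [← Finset.sum_sdiff htI, ← Finset.sum_sdiff htI]
    refine ((ih (I \ t) hcard).add hstar).mono subset_rfl ?_
    rw [← Finset.card_sdiff_add_card_eq_card htI, add_mul, ht]
    exact Nat.add_le_add_left (Nat.le_mul_of_pos_left _ hr) _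

theorem convertible_gather {κ : Type*} [Fintype κ] (hF : F.IsRegularOfDegree r) (hr : 0 < r)
    (hG : HasCommonNeighbors G (3 * r) b) {tip port : κ → V} (hport : Function.Injective port)
    (hpR : p ∈ R) (htR : ∀ i, tip i ∈ R) (hR : ∀ i, port i ∈ R) (ht : ∀ i j, port i ≠ tip j)
    (hp : ∀ i, port i ≠ p) (htp : ∀ i, tip i ≠ p)
    (hdvd : ∀ v, r ∣ (Finset.univ.filter fun i => tip i = v).card) :
    Convertible F G b R (Fintype.card κ * starCost r (Fintype.card W)) (matchingEdges tip port)
      (starEdges p port) := by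
  have htip : ∀ i ∈ (Finset.univ : Finset κ), tip i ∈ Finset.univ.image tip := fun i hi =>
    Finset.mem_image_of_mem _ hi
  have h := Convertible.sum (Finset.univ.image tip) (R := R) (F := F) (G := G) (b := b)
    (k := fun v => (Finset.univ.filter fun i => tip i = v).card * starCost r (Fintype.card W))
    (P := fun v => ∑ i with tip i = v, {s(tip i, port i)})
    (Q := fun v => ∑ i with tip i = v, {s(p, port i)}) fun v hv => by
      obtain ⟨i, -, rfl⟩ := Finset.mem_image.1 hv
      rw [Finset.sum_congr rfl fun j hj => by rw [(Finset.mem_filter.1 hj).2]]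
      exact convertible_gather_fiber hF hr hG hport (htR i) hpR hR (fun j => ht j i) hp (htp i)
        _ (hdvd _)
  rwa [Finset.sum_fiberwise_of_maps_to htip, Finset.sum_fiberwise_of_maps_to htip,
    ← Finset.sum_mul, ← Finset.card_eq_sum_card_fiberwise htip, Finset.card_univ] at h

/-- The number of new vertices that suffice to move the ends of `h` edges to a new vertex. -/
def portsCost (r f h : ℕ) : ℕ :=
  h * switchCost r f + 2 * h * starCost r f

theorem convertible_ports {J : Type*} [Fintype J] (hF : F.IsRegularOfDegree r) (hr : 0 < r)
    (hG : HasCommonNeighbors G (3 * r) b) {tip port : J × Bool → V}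
    (hport : Function.Injective port) (hpR : p ∈ R) (htR : ∀ i, tip i ∈ R) (hR : ∀ i, port i ∈ R)
    (ht : ∀ i j, port i ≠ tip j) (hp : ∀ i, port i ≠ p) (htp : ∀ i, tip i ≠ p)
    (htip : ∀ j, tip (j, false) ≠ tip (j, true))
    (hdvd : ∀ v, r ∣ (pairEdges tip).countP fun e => v ∈ e) :
    Convertible F G b R (portsCost r (Fintype.card W) (Fintype.card J))
      (pairEdges tip + pairEdges port + matchingEdges tip port)
      (matchingEdges tip port + starEdges p port) := by
  have hswitch := Convertible.sum Finset.univ fun (j : J) _ =>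
    convertible_switch hF hr hG (htR (j, false)) (htR (j, true)) (hR (j, false)) (hR (j, true))
      (htip j) (ht _ _).symm (ht _ _).symm (ht _ _).symm (hport.ne (by simp))
  have hgather := convertible_gather hF hr hG hport hpR htR hR ht hp htp fun v =>
    countP_pairEdges htip v ▸ hdvd v
  convert hswitch.add hgather using 1
  · simp [portsCost, mul_comm 2]
  · simp only [pairEdges, matchingEdges, Finset.sum_add_distrib, Sym2.eq_swap (b := tip (_, false))]
  · simp only [matchingEdges, Fintype.sum_prod_type, Fintype.sum_bool,
      Sym2.eq_swap (b := tip (_, false))]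
    exact congrArg (· + _) (Finset.sum_congr rfl fun _ _ => add_comm _ _)

theorem convertible_contract (hF : F.IsRegularOfDegree r) (hr : 0 < r)
    (hG : HasCommonNeighbors G (3 * r) b) {port : F.edgeSet × Bool → V}
    (hport : Function.Injective port) (hpR : p ∈ R) (hR : ∀ i, port i ∈ R)
    (hp : ∀ i, port i ≠ p) :
    Convertible F G b R (Fintype.card W + portsCost r (Fintype.card W) F.edgeFinset.card)
      (starEdges p port) (pairEdges port) := by
  let tip : F.edgeSet × Bool → W := ends fun e => e.1
  let att (w : W) : Finset V := (Finset.univ.filter fun i => tip i = w).image port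
  have hatt : ∀ w, (att w).card ≤ r := fun w =>
    Finset.card_image_le.trans ((card_filter_ends F w).trans (hF.degree_eq w)).le
  refine Convertible.of_isRootedEmbedding hG att F (fun w => ?_) (fun w => ?_) le_rfl
    fun φ hφ hφR => ?_
  · have := hatt w
    have := hF.degree_eq w
    omega
  · grind
  have hφne : ∀ {u}, u ∈ R → ∀ w, φ w ≠ u := fun hu w h => hφR w (h ▸ hu)
  refine ⟨copyEdges F φ + matchingEdges (φ ∘ tip) port, ?_, ?_, ?_⟩
  · refine Multiset.nodup_add.2 ⟨copyEdges_nodup F hφ,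
      matchingEdges_nodup hport fun i j => (hφne (hR i) _).symm, ?_⟩
    simp only [Multiset.disjoint_left, mem_copyEdges, mem_matchingEdges]
    rintro e ⟨a, c, -, rfl⟩ ⟨i, h⟩
    rcases Sym2.eq_iff.1 h with ⟨-, h⟩ | ⟨h, -⟩
    exacts [hφne (hR i) c h, hφne (hR i) a h]
  · simp only [Multiset.mem_add, mem_copyEdges, mem_matchingEdges]
    rintro e (⟨a, c, hac, rfl⟩ | ⟨i, rfl⟩)
    · exact mk_mem_newEdges hac
    · exact Sym2.eq_swap ▸ mk_root_mem_newEdges (x := tip i)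
        (Finset.mem_image_of_mem port (by simp))
  · have hports := convertible_ports hF hr hG (p := p) (tip := φ ∘ tip)
      (R := R ∪ Finset.univ.image φ) hport (Finset.mem_union_left _ hpR)
      (fun i => Finset.mem_union_right _ (Finset.mem_image_of_mem φ (Finset.mem_univ _)))
      (fun i => Finset.mem_union_left _ (hR i)) (fun i j => (hφne (hR i) _).symm) hp
      (fun i => hφne hpR _) (fun e => hφ.ne (ends_ne (F.not_isDiag_of_mem_edgeSet e.2))) (by
        rw [pairEdges_comp_ends]
        exact dvd_countP_copyEdges (fun w => (hF.degree_eq w).symm.dvd) hφ)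
    rw [pairEdges_comp_ends, ← SimpleGraph.edgeFinset_card] at hports
    convert hports.symm.add_decomposable_left (copyEdges_mem_decomposable F hφ) using 1 <;> abel

/-- The number of new vertices in an absorber for `k * D` edges, where `F` has `f` vertices and
`D` edges. -/
def absorberCost (r f D k : ℕ) : ℕ :=
  1 + (2 * (k * D) + (portsCost r f (k * D) + k * (f + portsCost r f D)))

theorem convertible_pairEdges_zero {k : ℕ} (hF : F.IsRegularOfDegree r) (hr : 0 < r)
    (hG : HasCommonNeighbors G (3 * r) b) {tip : (Fin k × F.edgeSet) × Bool → V} (hpR : p ∈ R)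
    (htR : ∀ i, tip i ∈ R) (htp : ∀ i, tip i ≠ p) (htip : ∀ j, tip (j, false) ≠ tip (j, true))
    (hdvd : ∀ v, r ∣ (pairEdges tip).countP fun e => v ∈ e) :
    Convertible F G b R (2 * (k * F.edgeFinset.card) +
        (portsCost r (Fintype.card W) (k * F.edgeFinset.card) +
          k * (Fintype.card W + portsCost r (Fintype.card W) F.edgeFinset.card)))
      (pairEdges tip) 0 := by
  refine Convertible.of_isRootedEmbedding hG (fun i => {tip i, p}) (⊥ □ ⊤) (fun i => ?_)
    (fun i => by grind) ?_ fun port hport hportR => ?_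
  · have : ({tip i, p} : Finset V).card ≤ 2 := Finset.card_le_two
    rw [SimpleGraph.degree_boxProd, SimpleGraph.bot_degree, SimpleGraph.complete_graph_degree,
      Fintype.card_bool]
    omega
  · simp [SimpleGraph.edgeFinset_card, mul_comm]
  have hne : ∀ {u}, u ∈ R → ∀ i, port i ≠ u := fun hu i h => hportR i (h ▸ hu)
  have hport_mem : ∀ i, port i ∈ R ∪ Finset.univ.image port := fun i =>
    Finset.mem_union_right _ (Finset.mem_image_of_mem port (Finset.mem_univ i))
  have hp_mem : p ∈ R ∪ Finset.univ.image port := Finset.mem_union_left _ hpR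
  refine ⟨pairEdges port + matchingEdges tip port + starEdges p port, ?_, ?_, ?_⟩
  · simp only [Multiset.nodup_add, pairEdges_nodup hport, starEdges_nodup hport,
      matchingEdges_nodup hport fun i j => hne (htR j) i, Multiset.disjoint_left, Multiset.mem_add,
      mem_pairEdges, mem_matchingEdges, mem_starEdges, true_and]
    grind
  · simp only [Multiset.mem_add, mem_pairEdges, mem_matchingEdges, mem_starEdges]
    rintro e ((⟨j, rfl⟩ | ⟨i, rfl⟩) | ⟨i, rfl⟩)
    · exact mk_mem_newEdges (SimpleGraph.boxProd_adj.2 (Or.inr ⟨by simp, rfl⟩))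
    all_goals exact mk_root_mem_newEdges (by simp)
  · have hports := convertible_ports hF hr hG hport hp_mem
      (fun i => Finset.mem_union_left _ (htR i)) hport_mem (fun i j => hne (htR j) i) (hne hpR)
      htp htip hdvd
    have hcontract := Convertible.sum (Finset.univ : Finset (Fin k)) fun l _ =>
      convertible_contract hF hr hG (port := fun i => port ((l, i.1), i.2))
        (fun i j h => by simpa [Prod.ext_iff] using hport h) hp_mem (fun i => hport_mem _)
        fun i => hne hpR _
    have hstar : ∑ l, starEdges p (fun i : F.edgeSet × Bool => port ((l, i.1), i.2)) =
        starEdges p port := by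
      simp only [starEdges, Fintype.sum_prod_type]
    have hpair : ∑ l, pairEdges (fun i : F.edgeSet × Bool => port ((l, i.1), i.2)) =
        pairEdges port := by
      simp only [pairEdges, matchingEdges, Fintype.sum_prod_type]
    rw [hstar, hpair] at hcontract
    convert hports.add hcontract using 1
    · simp [SimpleGraph.edgeFinset_card]
    all_goals abel

theorem convertible_absorber (hF : F.IsRegularOfDegree r) (hr : 0 < r)
    (hG : HasCommonNeighbors G (3 * r) b) {P : Multiset (Sym2 V)} {k : ℕ}
    (hcard : Multiset.card P = k * F.edgeFinset.card) (hdiag : ∀ e ∈ P, ¬e.IsDiag)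
    (hPR : ∀ e ∈ P, ∀ v ∈ e, v ∈ R) (hdvd : ∀ v, r ∣ P.countP fun e => v ∈ e) :
    Convertible F G b R (absorberCost r (Fintype.card W) F.edgeFinset.card k) P 0 := by
  obtain ⟨tip, rfl⟩ := exists_pairEdges_eq (J := Fin k × F.edgeSet) (P := P)
    (by simp [hcard, SimpleGraph.edgeFinset_card])
  have htip : ∀ j, s(tip (j, false), tip (j, true)) ∈ pairEdges tip := fun j =>
    mem_pairEdges.2 ⟨j, rfl⟩
  have htR : ∀ i, tip i ∈ R := by
    rintro ⟨j, _ | _⟩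
    exacts [hPR _ (htip j) _ (Sym2.mem_mk_left _ _), hPR _ (htip j) _ (Sym2.mem_mk_right _ _)]
  refine Convertible.of_isRootedEmbedding (X := Unit) hG (fun _ => ∅) ⊥ (fun _ => by simp)
    (fun _ => Finset.empty_subset _) le_rfl fun φ _ hφR => ⟨0, Multiset.nodup_zero, by simp, ?_⟩
  rw [add_zero, add_zero]
  exact convertible_pairEdges_zero hF hr hG (p := φ ())
    (Finset.mem_union_right _ (Finset.mem_image_of_mem φ (Finset.mem_univ _)))
    (fun i => Finset.mem_union_left _ (htR i)) (fun i h => hφR _ (h ▸ htR i))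
    (fun j => hdiag _ (htip j)) hdvd

end Exchanges

section Decomposition

variable {W V : Type*} {F : SimpleGraph W} {K : SimpleGraph V} {T T₁ T₂ : Multiset (Sym2 V)} {r : ℕ}

/-- The subgraphs in `D` form an `F`-decomposition of the part of `K` with the edges in `T`. -/
structure IsPacking (F : SimpleGraph W) (D : Set K.Subgraph) (T : Multiset (Sym2 V)) : Prop where
  nonempty_iso : ∀ L ∈ D, Nonempty (F ≃g L.coe)
  disjoint : ∀ L ∈ D, ∀ L' ∈ D, L ≠ L' → Disjoint L.edgeSet L'.edgeSet
  iUnion_edgeSet : ⋃ L ∈ D, L.edgeSet = {e | e ∈ T}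

theorem isPacking_zero : IsPacking F (∅ : Set K.Subgraph) 0 :=
  ⟨by simp, by simp, by simp⟩

theorem IsPacking.union {D₁ D₂ : Set K.Subgraph} (h₁ : IsPacking F D₁ T₁)
    (h₂ : IsPacking F D₂ T₂) (hT : Disjoint T₁ T₂) : IsPacking F (D₁ ∪ D₂) (T₁ + T₂) where
  nonempty_iso L hL := hL.elim (h₁.nonempty_iso L) (h₂.nonempty_iso L)
  disjoint := by
    have hd : ∀ L ∈ D₁, ∀ L' ∈ D₂, Disjoint L.edgeSet L'.edgeSet := by
      refine fun L hL L' hL' => Set.disjoint_left.2 fun e he he' => ?_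
      have he₁ : e ∈ {e | e ∈ T₁} := h₁.iUnion_edgeSet ▸ Set.mem_biUnion hL he
      have he₂ : e ∈ {e | e ∈ T₂} := h₂.iUnion_edgeSet ▸ Set.mem_biUnion hL' he'
      exact Multiset.disjoint_left.1 hT he₁ he₂
    rintro L (hL | hL) L' (hL' | hL') hne
    exacts [h₁.disjoint L hL L' hL' hne, hd L hL L' hL', (hd L' hL' L hL).symm,
      h₂.disjoint L hL L' hL' hne]
  iUnion_edgeSet := by
    rw [Set.biUnion_union, h₁.iUnion_edgeSet, h₂.iUnion_edgeSet]
    ext e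
    simp

variable [Fintype W]

theorem isPacking_copy (c : SimpleGraph.Copy F K) :
    IsPacking F {c.toSubgraph} (copyEdges F c) where
  nonempty_iso := by
    rintro L rfl
    exact ⟨c.isoToSubgraph⟩
  disjoint := by
    rintro L rfl L' rfl h
    exact (h rfl).elim
  iUnion_edgeSet := by
    ext e
    simp only [Set.mem_singleton_iff, Set.iUnion_iUnion_eq_left, SimpleGraph.Subgraph.edgeSet_map,
      SimpleGraph.Subgraph.edgeSet_top, copyEdges, Set.mem_image, Set.mem_ofPred_eq,
      Multiset.mem_map, Finset.mem_val, SimpleGraph.mem_edgeFinset]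
    rfl

theorem dvd_card_of_decomposable (hT : T ∈ decomposable F V) :
    F.edgeFinset.card ∣ Multiset.card T := by
  induction hT using AddSubmonoid.closure_induction with
  | mem x hx =>
    obtain ⟨φ, -, rfl⟩ := hx
    rw [card_copyEdges]
  | zero => simp
  | add x y _ _ hx hy => simpa using dvd_add hx hy

theorem dvd_countP_of_decomposable (hF : ∀ w, r ∣ F.degree w) (hT : T ∈ decomposable F V) (v : V) :
    r ∣ T.countP fun e => v ∈ e := by
  induction hT using AddSubmonoid.closure_induction with
  | mem x hx =>
    obtain ⟨φ, hφ, rfl⟩ := hx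
    exact dvd_countP_copyEdges hF hφ v
  | zero => simp
  | add x y _ _ hx hy => simpa using dvd_add hx hy

theorem exists_isPacking (hT : T ∈ decomposable F V) (hn : T.Nodup) (hK : ∀ e ∈ T, e ∈ K.edgeSet) :
    ∃ D : Set K.Subgraph, IsPacking F D T := by
  induction hT using AddSubmonoid.closure_induction with
  | mem x hx =>
    obtain ⟨φ, hφ, rfl⟩ := hx
    exact ⟨_, isPacking_copy ⟨⟨φ, fun h => hK _ (mem_copyEdges.2 ⟨_, _, h, rfl⟩)⟩, hφ⟩⟩
  | zero => exact ⟨∅, isPacking_zero⟩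
  | add x y _ _ hx hy =>
    obtain ⟨hnx, hny, hxy⟩ := Multiset.nodup_add.1 hn
    obtain ⟨D₁, h₁⟩ := hx hnx fun e he => hK e (Multiset.mem_add.2 (Or.inl he))
    obtain ⟨D₂, h₂⟩ := hy hny fun e he => hK e (Multiset.mem_add.2 (Or.inr he))
    exact ⟨D₁ ∪ D₂, h₁.union h₂ hxy⟩

variable [Fintype V]

theorem degreeGcd_dvd_degree (K : SimpleGraph V) (v : V) : degreeGcd K ∣ K.degree v :=
  Finset.gcd_dvd (f := fun v => K.degree v) (Finset.mem_univ v)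

theorem hasDecomposition_of_mem_decomposable (h : K.edgeFinset.val ∈ decomposable F V) :
    HasDecomposition F K := by
  obtain ⟨D, hD⟩ := exists_isPacking h K.edgeFinset.nodup (fun e he => by simpa using he)
  exact ⟨D, hD.nonempty_iso, hD.disjoint, hD.iUnion_edgeSet.trans (by ext e; simp)⟩

theorem isDivisible_of_mem_decomposable (h : K.edgeFinset.val ∈ decomposable F V) :
    IsDivisible F K := by
  refine ⟨dvd_card_of_decomposable h, Finset.dvd_gcd fun v _ => ?_⟩
  rw [← countP_mem_edgeFinset]
  exact dvd_countP_of_decomposable (degreeGcd_dvd_degree F) h v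

theorem IsDivisible.dvd_degree (hF : F.IsRegularOfDegree r) (h : IsDivisible F K) (v : V) :
    r ∣ K.degree v := by
  have hr : r ∣ degreeGcd F := Finset.dvd_gcd fun w _ => (hF.degree_eq w).symm ▸ dvd_rfl
  exact (hr.trans h.2).trans (degreeGcd_dvd_degree K v)

end Decomposition

section Counting

variable {V : Type*} {G : SimpleGraph V} {R N : Finset V} {T E : Multiset (Sym2 V)}

theorem sum_countP_mem_le [Fintype V] (T : Multiset (Sym2 V)) :
    ∑ v, T.countP (fun e => v ∈ e) ≤ 2 * Multiset.card T := by
  induction T using Multiset.induction_on with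
  | empty => simp
  | cons e T ih =>
    have he : (Finset.univ.filter fun v => v ∈ e).card ≤ 2 := by
      induction e with
      | _ a b =>
        refine (Finset.card_le_card (t := {a, b}) fun v hv => ?_).trans Finset.card_le_two
        simpa [Sym2.mem_iff] using hv
    simp only [Multiset.countP_cons, Finset.sum_add_distrib, Multiset.card_cons,
      ← Finset.card_filter]
    omega

theorem sum_countP_mem [Fintype V] (hT : ∀ e ∈ T, ¬e.IsDiag) :
    ∑ v, T.countP (fun e => v ∈ e) = 2 * Multiset.card T := by
  induction T using Multiset.induction_on with
  | empty => simp
  | cons e T ih =>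
    have he : (Finset.univ.filter fun v => v ∈ e).card = 2 := by
      have hdiag := hT e (Multiset.mem_cons_self e T)
      induction e with
      | _ a b =>
        rw [← Finset.card_pair (a := a) (b := b) (by simpa using hdiag)]
        congr 1
        ext v
        simp [Sym2.mem_iff]
    simp only [Multiset.countP_cons, Finset.sum_add_distrib, Multiset.card_cons,
      ← Finset.card_filter, he, ih fun d hd => hT d (Multiset.mem_cons_of_mem hd), mul_add, mul_one]

theorem Fresh.card_le (h : Fresh G R N T) : Multiset.card T ≤ (R.card + N.card) ^ 2 := by
  have hsub : T.toFinset ⊆ ((R ∪ N) ×ˢ (R ∪ N)).image fun q => s(q.1, q.2) := by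
    intro e he
    have hs := h.subset e (Multiset.mem_toFinset.1 he)
    induction e with
    | _ a b =>
      exact Finset.mem_image.2 ⟨(a, b), Finset.mem_product.2
        ⟨Finset.mem_union.2 (hs a (by simp)), Finset.mem_union.2 (hs b (by simp))⟩, rfl⟩
  rw [← Multiset.toFinset_card_of_nodup h.nodup]
  refine (Finset.card_le_card hsub).trans (Finset.card_image_le.trans ?_)
  rw [Finset.card_product, sq]
  exact Nat.mul_le_mul (Finset.card_union_le _ _) (Finset.card_union_le _ _)

theorem Fresh.countP_le (h : Fresh G R N T) (v : V) :
    T.countP (fun e => v ∈ e) ≤ R.card + N.card := by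
  rw [Multiset.countP_eq_card_filter, ← Multiset.toFinset_card_of_nodup (h.nodup.filter _)]
  refine (Finset.card_le_card (t := (R ∪ N).image fun w => s(v, w)) fun e he => ?_).trans
    (Finset.card_image_le.trans (Finset.card_union_le _ _))
  rw [Multiset.mem_toFinset, Multiset.mem_filter] at he
  obtain ⟨he, w, rfl⟩ := he
  exact Finset.mem_image_of_mem _ (Finset.mem_union.2 (h.subset _ he w (Sym2.mem_mk_right _ _)))

theorem Fresh.countP_eq_zero (h : Fresh G R N T) {v : V} (hR : v ∉ R) (hN : v ∉ N) :
    T.countP (fun e => v ∈ e) = 0 :=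
  Multiset.countP_eq_zero.2 fun e he hv => (h.subset e he v hv).elim hR hN

variable [Fintype V] {a d k b : ℕ}

theorem degree_le_degree_add {G' : SimpleGraph V}
    (hG' : ∀ v w, G.Adj v w → s(v, w) ∉ E → G'.Adj v w)
    (hE : ∀ v, E.countP (fun e => v ∈ e) ≤ d) (v : V) : G.degree v ≤ G'.degree v + d := by
  have hdel : (Finset.univ.filter fun w => s(v, w) ∈ E).card ≤ d := by
    refine le_trans ?_ (hE v)
    rw [Multiset.countP_eq_card_filter]
    refine le_trans ?_ (Multiset.toFinset_card_le _)
    refine Finset.card_le_card_of_injOn (fun w => s(v, w)) (fun w hw => ?_)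
      fun w _ w' _ h => Sym2.congr_right.1 h
    simpa using hw
  rw [← SimpleGraph.card_neighborFinset_eq_degree, ← SimpleGraph.card_neighborFinset_eq_degree]
  refine (Finset.card_le_card (t := G'.neighborFinset v ∪
    Finset.univ.filter fun w => s(v, w) ∈ E) fun w hw => ?_).trans
    ((Finset.card_union_le _ _).trans (Nat.add_le_add_left hdel _))
  simpa [or_iff_not_imp_right] using hG' v w (by simpa using hw)

theorem hasCommonNeighbors_of_le_degree (hG : ∀ v, Fintype.card V ≤ G.degree v + a)
    (hb : k * a + b ≤ Fintype.card V) : HasCommonNeighbors G k b := by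
  intro S B hS hB
  by_contra! hcon
  have hcover : (Finset.univ : Finset V) ⊆ B ∪ S.biUnion fun v => (G.neighborFinset v)ᶜ := by
    intro w _
    by_cases hw : w ∈ B
    · exact Finset.mem_union_left _ hw
    · obtain ⟨v, hv, hvw⟩ := hcon w hw
      exact Finset.mem_union_right _ (Finset.mem_biUnion.2 ⟨v, hv, by simpa using hvw⟩)
  have hnon : ∀ v, (G.neighborFinset v)ᶜ.card ≤ a := fun v => by
    rw [Finset.card_compl, SimpleGraph.card_neighborFinset_eq_degree]
    have := hG v
    omega
  have hcard := (Finset.card_le_card hcover).trans ((Finset.card_union_le _ _).trans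
    (Nat.add_le_add_left (Finset.card_biUnion_le_card_mul _ _ _ fun v _ => hnon v) _))
  rw [Finset.card_univ] at hcard
  have := Nat.mul_le_mul_right a hS
  omega

end Counting

section Families

variable {V ι : Type*} {G : SimpleGraph V} {R : ι → Finset V}
  {Φ : ι → Multiset (Sym2 V) → Prop} {a b k l θ K ρ : ℕ} {s : Finset ι} {T : ι → Multiset (Sym2 V)}

/-- The edge sets `T i` of `G`, for `i ∈ s`, are edge-disjoint gadgets with roots `R i` and the
properties `Φ i`. Since the new vertices of each gadget are chosen among those of degree at most `θ`
in the previous ones, a large degree at `v` can only be due to gadgets with root `v`. -/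
structure IsEdgeDisjointFamily (G : SimpleGraph V) (R : ι → Finset V)
    (Φ : ι → Multiset (Sym2 V) → Prop) (θ K : ℕ) (s : Finset ι) (T : ι → Multiset (Sym2 V)) :
    Prop where
  prop : ∀ i ∈ s, Φ i (T i)
  nodup : (∑ i ∈ s, T i).Nodup
  mem_edgeSet : ∀ e ∈ ∑ i ∈ s, T i, e ∈ G.edgeSet
  countP_le : ∀ v, (∑ i ∈ s, T i).countP (fun e => v ∈ e) ≤
    θ + K * ((s.filter fun i => v ∈ R i).card + 1)
  card_le : Multiset.card (∑ i ∈ s, T i) ≤ s.card * K ^ 2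

protected theorem IsEdgeDisjointFamily.insert (h : IsEdgeDisjointFamily G R Φ θ K s T) {i : ι}
    (hi : i ∉ s) {N : Finset V} {S : Multiset (Sym2 V)}
    (hS : Fresh (G.deleteEdges {e | e ∈ ∑ i ∈ s, T i}) (R i) N S) (hK : (R i).card + N.card ≤ K)
    (hN : ∀ v ∈ N, (∑ i ∈ s, T i).countP (fun e => v ∈ e) ≤ θ) (hΦ : Φ i S) :
    IsEdgeDisjointFamily G R Φ θ K (insert i s) (Function.update T i S) := by
  have hT : ∀ j ∈ s, Function.update T i S j = T j := fun j hj =>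
    Function.update_of_ne (ne_of_mem_of_not_mem hj hi) ..
  have hsum : ∑ j ∈ insert i s, Function.update T i S j = S + ∑ j ∈ s, T j := by
    rw [Finset.sum_insert hi, Function.update_self, Finset.sum_congr rfl hT]
  have hSG : ∀ e ∈ S, e ∈ G.edgeSet ∧ e ∉ ∑ i ∈ s, T i := fun e he => by
    simpa [SimpleGraph.edgeSet_deleteEdges] using hS.mem_edgeSet e he
  refine ⟨fun j hj => ?_, ?_, ?_, fun v => ?_, ?_⟩
  · rcases Finset.mem_insert.1 hj with rfl | hj
    · rwa [Function.update_self]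
    · rw [hT j hj]
      exact h.prop j hj
  · rw [hsum]
    exact Multiset.nodup_add.2
      ⟨hS.nodup, h.nodup, Multiset.disjoint_left.2 fun {e} he => (hSG e he).2⟩
  · rw [hsum]
    exact fun e he => (Multiset.mem_add.1 he).elim (fun he => (hSG e he).1) (h.mem_edgeSet e)
  · have hnew := (hS.countP_le v).trans hK
    rw [hsum, Multiset.countP_add, Finset.filter_insert]
    split_ifs with hv
    · rw [Finset.card_insert_of_notMem (by simp [hi]), mul_add _ _ 1, mul_one]
      linarith [h.countP_le v]
    · by_cases hvN : v ∈ N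
      · rw [mul_add, mul_one]
        linarith [hN v hvN, Nat.zero_le (K * (s.filter fun i => v ∈ R i).card)]
      · rw [hS.countP_eq_zero hv hvN, zero_add]
        exact h.countP_le v
  · rw [hsum, Multiset.card_add, Finset.card_insert_of_notMem hi, add_mul, one_mul, add_comm]
    exact Nat.add_le_add h.card_le (hS.card_le.trans (Nat.pow_le_pow_left hK 2))

variable [Fintype V]

theorem card_filter_lt_countP_mul_le (E : Multiset (Sym2 V)) (θ : ℕ) :
    (Finset.univ.filter fun v => θ < E.countP fun e => v ∈ e).card * θ ≤ 2 * Multiset.card E :=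
  calc
    _ ≤ ∑ v ∈ Finset.univ.filter fun v => θ < E.countP fun e => v ∈ e,
          E.countP (fun e => v ∈ e) := by
      rw [← smul_eq_mul]
      exact Finset.card_nsmul_le_sum _ _ _ fun v hv => (Finset.mem_filter.1 hv).2.le
    _ ≤ ∑ v, E.countP (fun e => v ∈ e) := Finset.sum_le_sum_of_subset (Finset.subset_univ _)
    _ ≤ 2 * Multiset.card E := sum_countP_mem_le E

theorem exists_isEdgeDisjointFamily (hG : ∀ v, Fintype.card V ≤ G.degree v + a)
    (hK : ∀ i ∈ s, (R i).card + k ≤ K) (hρ : ∀ v, (s.filter fun i => v ∈ R i).card ≤ ρ)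
    (hθ : 0 < θ) (hl : l * (a + (θ + K * (ρ + 1))) + b ≤ Fintype.card V)
    (hb : 2 * (s.card * K ^ 2) / θ + K ≤ b)
    (h : ∀ i ∈ s, ∀ G' : SimpleGraph V, HasCommonNeighbors G' l b →
      HasFreshEdges G' b (R i) k (Φ i)) :
    ∃ T, IsEdgeDisjointFamily G R Φ θ K s T := by
  suffices H : ∀ u ⊆ s, ∃ T, IsEdgeDisjointFamily G R Φ θ K u T from H s subset_rfl
  intro u
  induction u using Finset.induction_on with
  | empty => exact fun _ => ⟨fun _ => 0, by simp, by simp, by simp, by simp, by simp⟩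
  | insert i u hi ih =>
    intro hu
    have his : i ∈ s := hu (Finset.mem_insert_self _ _)
    have hus : u ⊆ s := (Finset.subset_insert _ _).trans hu
    obtain ⟨T, hT⟩ := ih hus
    set E := ∑ i ∈ u, T i
    have hnbr : HasCommonNeighbors (G.deleteEdges {e | e ∈ E}) l b := by
      have hE : ∀ v, E.countP (fun e => v ∈ e) ≤ θ + K * (ρ + 1) := fun v =>
        (hT.countP_le v).trans (by gcongr; exact (Finset.card_le_card (by gcongr)).trans (hρ v))
      refine hasCommonNeighbors_of_le_degree (fun v => ?_) hl
      have hdel : ∀ v w, G.Adj v w → s(v, w) ∉ E → (G.deleteEdges {e | e ∈ E}).Adj v w :=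
        fun v w hvw hE => SimpleGraph.deleteEdges_adj.2 ⟨hvw, hE⟩
      linarith [hG v, degree_le_degree_add hdel hE v]
    set full := Finset.univ.filter fun v => θ < E.countP fun e => v ∈ e
    have hfull : full.card ≤ 2 * (s.card * K ^ 2) / θ := by
      refine (Nat.le_div_iff_mul_le hθ).2 ((card_filter_lt_countP_mul_le E θ).trans ?_)
      have hcard := Finset.card_le_card hus
      gcongr
      exact hT.card_le.trans (by gcongr)
    obtain ⟨N, S, hN, hNk, hS, hΦ⟩ := h i his _ hnbr (R i ∪ full) Finset.subset_union_left (by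
      linarith [Finset.card_union_le (R i) full, hK i his])
    refine ⟨_, hT.insert hi hS ((Nat.add_le_add_left hNk _).trans (hK i his)) (fun v hv => ?_) hΦ⟩
    have hvN := fun hv' => Finset.disjoint_left.1 hN hv (Finset.mem_union_right _ hv')
    simpa [full] using hvN

end Families

section Carrier

variable {W V : Type*} [Fintype W] {F : SimpleGraph W} {G : SimpleGraph V} {b r : ℕ}

/-- The graph obtained from `g` disjoint copies of `F` by replacing the edge `xy` in each copy by
edges from `x` and `y` to a common new vertex: each replacement adds one edge and leaves the degrees
in the copy unchanged. The carriers are copies of this graph. -/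
def loopGraph (F : SimpleGraph W) (x y : W) (g : ℕ) : SimpleGraph (Option (Fin g × W)) where
  Adj
    | none, none => False
    | none, some (_, w) => w = x ∨ w = y
    | some (_, w), none => w = x ∨ w = y
    | some (j, w), some (j', w') => j = j' ∧ F.Adj w w' ∧ s(w, w') ≠ s(x, y)
  symm := ⟨by
    rintro (_ | ⟨j, w⟩) (_ | ⟨j', w'⟩) h
    · exact h
    · exact h
    · exact h
    · exact ⟨h.1.symm, h.2.1.symm, by rw [Sym2.eq_swap]; exact h.2.2⟩⟩
  loopless := ⟨by
    rintro (_ | ⟨j, w⟩) h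
    · exact h
    · exact h.2.1.ne rfl⟩

theorem degree_loopGraph_none {x y : W} (hxy : x ≠ y) (g : ℕ) :
    (loopGraph F x y g).degree none = 2 * g := by
  have h : (loopGraph F x y g).neighborFinset none =
      ((Finset.univ : Finset (Fin g)) ×ˢ ({x, y} : Finset W)).image some := by
    ext o
    rw [SimpleGraph.mem_neighborFinset]
    rcases o with _ | ⟨j, w⟩
    · simp
    · simp [loopGraph]
  rw [← SimpleGraph.card_neighborFinset_eq_degree, h,
    Finset.card_image_of_injective _ (Option.some_injective _), Finset.card_product,
    Finset.card_pair hxy, Finset.card_univ, Fintype.card_fin, mul_comm]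

theorem degree_loopGraph_some {x y : W} (hxy : F.Adj x y) {g : ℕ} (q : Fin g × W) :
    (loopGraph F x y g).degree (some q) = F.degree q.2 := by
  obtain ⟨j, w⟩ := q
  let ψ : W → Option (Fin g × W) := fun w' => if s(w, w') = s(x, y) then none else some (j, w')
  have h : (loopGraph F x y g).neighborFinset (some (j, w)) = (F.neighborFinset w).image ψ := by
    ext o
    rw [SimpleGraph.mem_neighborFinset, Finset.mem_image]
    simp only [SimpleGraph.mem_neighborFinset, ψ]
    rcases o with _ | ⟨j', w'⟩
    · constructor
      · rintro (rfl | rfl)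
        · exact ⟨y, hxy, if_pos rfl⟩
        · exact ⟨x, hxy.symm, if_pos Sym2.eq_swap⟩
      · rintro ⟨w', -, h⟩
        split_ifs at h with h'
        exact (Sym2.eq_iff.1 h').imp And.left And.left
    · constructor
      · rintro ⟨rfl, h, h'⟩
        exact ⟨w', h, if_neg h'⟩
      · rintro ⟨u, hu, h⟩
        split_ifs at h with h'
        obtain ⟨rfl, rfl⟩ := Prod.mk.inj (Option.some.inj h)
        exact ⟨rfl, hu, h'⟩
  rw [← SimpleGraph.card_neighborFinset_eq_degree, h, Finset.card_image_of_injOn,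
    SimpleGraph.card_neighborFinset_eq_degree]
  intro u _ u' _ huu
  simp only [ψ] at huu
  split_ifs at huu with h1 h2
  · exact Sym2.congr_right.1 (h1.trans h2.symm)
  · exact (Prod.mk.inj (Option.some.inj huu)).2

theorem card_edgeFinset_loopGraph {x y : W} (hxy : F.Adj x y) (g : ℕ) :
    (loopGraph F x y g).edgeFinset.card = g * (1 + F.edgeFinset.card) := by
  have h := (loopGraph F x y g).sum_degrees_eq_twice_card_edges
  have h' := F.sum_degrees_eq_twice_card_edges
  rw [Fintype.sum_option, degree_loopGraph_none hxy.ne, Fintype.sum_prod_type] at h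
  have h2 : ∀ (j : Fin g) w, (loopGraph F x y g).degree (some (j, w)) = F.degree w := fun j w =>
    degree_loopGraph_some hxy (j, w)
  simp only [h2] at h
  rw [h', Finset.sum_const, Finset.card_univ, Fintype.card_fin, smul_eq_mul] at h
  have : 2 * (loopGraph F x y g).edgeFinset.card = 2 * (g * (1 + F.edgeFinset.card)) := by
    rw [← h]; ring
  omega

theorem hasFreshEdges_carrier (hF : F.IsRegularOfDegree r) (hG : HasCommonNeighbors G (3 * r) b)
    {x y : W} (hxy : F.Adj x y) {g : ℕ} (hg : r ∣ 2 * g) (hgr : g ≤ r) :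
    HasFreshEdges G b ∅ (1 + g * Fintype.card W) fun T =>
      (∀ v, r ∣ T.countP fun e => v ∈ e) ∧ Multiset.card T = g * (1 + F.edgeFinset.card) := by
  intro B _ hB
  have hX : Fintype.card (Option (Fin g × W)) = 1 + g * Fintype.card W := by
    rw [Fintype.card_option, Fintype.card_prod, Fintype.card_fin, add_comm]
  have hdeg : ∀ o, (loopGraph F x y g).degree o = 2 * g ∨ (loopGraph F x y g).degree o = r := by
    rintro (_ | q)
    · exact Or.inl (degree_loopGraph_none hxy.ne g)
    · exact Or.inr ((degree_loopGraph_some hxy q).trans (hF.degree_eq _))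
  obtain ⟨φ, hφ⟩ := hG.exists_isRootedEmbedding (att := fun _ => ∅) (rel := loopGraph F x y g)
    (B := B) (fun o => by rcases hdeg o with h | h <;> rw [h, Finset.card_empty] <;> omega)
    (by rwa [hX])
  have hinj : Function.Injective φ := by simpa [Set.injOn_univ] using hφ.injOn
  refine ⟨Finset.univ.image φ, copyEdges (loopGraph F x y g) φ, ?_, ?_,
    hφ.fresh (fun _ => subset_rfl) (copyEdges_nodup _ hinj) fun e he => ?_, ?_, ?_⟩
  · simpa [Finset.disjoint_left] using fun o => hφ.notMem o (Finset.mem_univ o)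
  · exact Finset.card_image_le.trans hX.le
  · obtain ⟨o, o', h, rfl⟩ := mem_copyEdges.1 he
    exact mk_mem_newEdges h
  · exact dvd_countP_copyEdges (fun o => by rcases hdeg o with h | h <;> rw [h]; exact hg) hinj
  · rw [card_copyEdges, card_edgeFinset_loopGraph hxy]

theorem exists_dvd_two_mul_forall_dvd (hr : 0 < r) :
    ∃ g, 0 < g ∧ g ≤ r ∧ r ∣ 2 * g ∧ ∀ h, r ∣ 2 * h → g ∣ h := by
  rcases Nat.even_or_odd r with ⟨c, hc⟩ | hodd
  · refine ⟨c, by omega, by omega, by rw [hc, two_mul], fun h hh => ?_⟩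
    rw [hc, ← two_mul] at hh
    exact Nat.dvd_of_mul_dvd_mul_left two_pos hh
  · exact ⟨r, hr, le_rfl, dvd_mul_left _ _, fun h hh =>
      (Nat.Coprime.dvd_mul_left (Nat.coprime_two_right.2 hodd)).1 hh⟩

end Carrier

section Absorbers

variable {W V ι : Type*} [Fintype W] {F : SimpleGraph W} {G : SimpleGraph V}
  {T P : ι → Multiset (Sym2 V)} {s u : Finset ι} {r : ℕ}

/-- Divisibility of a multiset of edges by an `r`-regular graph with `D` edges. -/
structure DivisibleEdges (D r : ℕ) (P : Multiset (Sym2 V)) : Prop where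
  not_isDiag : ∀ e ∈ P, ¬e.IsDiag
  dvd_countP : ∀ v, r ∣ P.countP fun e => v ∈ e
  dvd_card : D ∣ Multiset.card P

theorem sum_add_sum_mem_decomposable (hT : ∀ i ∈ s, T i ∈ decomposable F V)
    (hTP : ∀ i ∈ s, T i + P i ∈ decomposable F V) (hu : u ⊆ s) :
    ∑ i ∈ s, T i + ∑ i ∈ u, P i ∈ decomposable F V := by
  rw [← Finset.sum_sdiff hu, add_assoc, ← Finset.sum_add_distrib]
  exact add_mem (sum_mem fun i hi => hT i (Finset.mem_sdiff.1 hi).1)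
    (sum_mem fun i hi => hTP i (hu hi))

theorem absorberCost_le_absorberCost (r f : ℕ) {D D' k k' : ℕ} (hD : D ≤ D') (hk : k ≤ k') :
    absorberCost r f D k ≤ absorberCost r f D' k' := by
  unfold absorberCost portsCost
  gcongr

variable [Fintype V]

/-- The set of the vertices of the edges in `T`. -/
noncomputable def supp (T : Multiset (Sym2 V)) : Finset V :=
  Finset.univ.filter fun v => ∃ e ∈ T, v ∈ e

theorem mem_supp {T : Multiset (Sym2 V)} {v : V} : v ∈ supp T ↔ ∃ e ∈ T, v ∈ e := by
  simp [supp]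

theorem card_supp_le (T : Multiset (Sym2 V)) : (supp T).card ≤ 2 * Multiset.card T := by
  refine le_trans ?_ (sum_countP_mem_le T)
  rw [Finset.card_eq_sum_ones]
  refine (Finset.sum_le_sum fun v hv => ?_).trans
    (Finset.sum_le_sum_of_subset (Finset.subset_univ _))
  exact Multiset.countP_pos.2 (mem_supp.1 hv)

theorem card_filter_mem_supp_le (s : Finset ι) (T : ι → Multiset (Sym2 V)) (v : V) :
    (s.filter fun i => v ∈ supp (T i)).card ≤ (∑ i ∈ s, T i).countP fun e => v ∈ e := by
  rw [countP_sum, Finset.card_eq_sum_ones]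
  refine (Finset.sum_le_sum fun i hi => ?_).trans
    (Finset.sum_le_sum_of_subset (Finset.filter_subset _ s))
  exact Multiset.countP_pos.2 (mem_supp.1 (Finset.mem_filter.1 hi).2)

theorem exists_absorbers [Nonempty W] {a b h θ K ρ : ℕ} (hF : F.IsRegularOfDegree r) (hr : 0 < r)
    (hP : ∀ i ∈ s, DivisibleEdges F.edgeFinset.card r (P i))
    (hPh : ∀ i ∈ s, Multiset.card (P i) ≤ h)
    (hρ : ∀ v, (s.filter fun i => v ∈ supp (P i)).card ≤ ρ)
    (hK : 2 * h + absorberCost r (Fintype.card W) F.edgeFinset.card h ≤ K)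
    (hG : ∀ v, Fintype.card V ≤ G.degree v + a) (hθ : 0 < θ)
    (hV : 3 * r * (a + (θ + K * (ρ + 1))) + b ≤ Fintype.card V)
    (hb : 2 * (s.card * K ^ 2) / θ + K ≤ b) :
    ∃ T, IsEdgeDisjointFamily G (fun i => supp (P i))
      (fun i T => T + P i ∈ decomposable F V ∧ T ∈ decomposable F V) θ K s T := by
  refine exists_isEdgeDisjointFamily
    (k := absorberCost r (Fintype.card W) F.edgeFinset.card h) hG
    (fun i hi => ?_) hρ hθ hV hb fun i hi G' hG' => ?_
  · have := card_supp_le (P i)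
    have := hPh i hi
    exact (Nat.add_le_add_right (by omega) _).trans hK
  · have habs := convertible_absorber (R := supp (P i)) hF hr hG'
      (Nat.div_mul_cancel (hP i hi).dvd_card).symm (hP i hi).not_isDiag
      (fun e he v hv => mem_supp.2 ⟨e, he, hv⟩) (hP i hi).dvd_countP
    simpa [Convertible] using habs.mono subset_rfl
      (absorberCost_le_absorberCost _ _ le_rfl ((Nat.div_le_self _ _).trans (hPh i hi)))

end Absorbers

section Balancing

variable {V : Type*} {G : SimpleGraph V} {C : ℕ → ℕ → Multiset (Sym2 V)} {q d r g D B : ℕ}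

/-- A system of carriers: edge-disjoint edge sets `C i l` for `i < q` and `l < d`, each of which has
all degrees divisible by `r` and `g * (1 + D)` edges, hence `g` edges modulo `D`. Moving carriers
from one colour class to another changes the numbers of edges to be absorbed there. -/
structure IsCarrierSystem (G : SimpleGraph V) (r g D q d B : ℕ) (C : ℕ → ℕ → Multiset (Sym2 V)) :
    Prop where
  eq_zero : ∀ i l, q ≤ i → C i l = 0
  dvd_countP : ∀ i, ∀ l < d, ∀ v, r ∣ (C i l).countP fun e => v ∈ e
  card_eq : ∀ i < q, ∀ l < d, Multiset.card (C i l) = g * (1 + D)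
  nodup : (∑ i ∈ Finset.range q, ∑ l ∈ Finset.range d, C i l).Nodup
  mem_edgeSet : ∀ e ∈ ∑ i ∈ Finset.range q, ∑ l ∈ Finset.range d, C i l, e ∈ G.edgeSet
  countP_le : ∀ v,
    (∑ i ∈ Finset.range q, ∑ l ∈ Finset.range d, C i l).countP (fun e => v ∈ e) ≤ B

/-- The edge set to be absorbed at the `i`-th colour class: a set of edges inside the class, the
carriers of the class from `u` on, and the first `u'` carriers of the next class, where the triple
of these three parameters is `t`. -/
noncomputable def exchange (C : ℕ → ℕ → Multiset (Sym2 V)) (d i : ℕ)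
    (t : Finset (Sym2 V) × ℕ × ℕ) : Multiset (Sym2 V) :=
  t.1.val + ∑ l ∈ Finset.Ico t.2.1 d, C i l + ∑ l ∈ Finset.range t.2.2, C (i + 1) l

theorem sum_exchange (E : ℕ → Finset (Sym2 V)) {u : ℕ → ℕ} (hu : ∀ i, u i ≤ d) (hu₀ : u 0 = 0)
    (huq : u q = 0) :
    ∑ i ∈ Finset.range q, exchange C d i (E i, u i, u (i + 1)) =
      ∑ i ∈ Finset.range q, (E i).val + ∑ i ∈ Finset.range q, ∑ l ∈ Finset.range d, C i l := by
  have hshift : ∑ i ∈ Finset.range q, ∑ l ∈ Finset.range (u (i + 1)), C (i + 1) l =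
      ∑ i ∈ Finset.range q, ∑ l ∈ Finset.range (u i), C i l := by
    have h := (Finset.sum_range_succ' (fun i => ∑ l ∈ Finset.range (u i), C i l) q).symm.trans
      (Finset.sum_range_succ _ q)
    simpa [hu₀, huq] using h
  have hsplit : ∀ i, ∑ l ∈ Finset.range d, C i l =
      ∑ l ∈ Finset.Ico (u i) d, C i l + ∑ l ∈ Finset.range (u i), C i l := fun i => by
    rw [add_comm, Finset.sum_range_add_sum_Ico _ (hu i)]
  simp only [exchange, Finset.sum_add_distrib, hshift, hsplit, add_assoc]

theorem IsCarrierSystem.not_isDiag (hC : IsCarrierSystem G r g D q d B C) {i l : ℕ} (hl : l < d)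
    {e : Sym2 V} (he : e ∈ C i l) : ¬e.IsDiag := by
  rcases lt_or_ge i q with hi | hi
  · exact G.not_isDiag_of_mem_edgeSet <| hC.mem_edgeSet e <| Multiset.mem_sum.2
      ⟨i, Finset.mem_range.2 hi, Multiset.mem_sum.2 ⟨l, Finset.mem_range.2 hl, he⟩⟩
  · simp [hC.eq_zero i l hi] at he

theorem IsCarrierSystem.divisibleEdges_exchange (hC : IsCarrierSystem G r g D q d B C)
    (hD : D = g * d) {i n u u' : ℕ} {E : Finset (Sym2 V)} (hi : i < q) (hu' : u' ≤ d)
    (hiu' : i + 1 = q → u' = 0) (hE : ∀ e ∈ E, ¬e.IsDiag)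
    (hEr : ∀ v, r ∣ E.val.countP fun e => v ∈ e) (hn : E.card = g * n)
    (hd : d ∣ n + (d - u) + u') :
    DivisibleEdges D r (exchange C d i (E, u, u')) := by
  have hlow : ∀ l ∈ Finset.range u', l < d := fun l hl => (Finset.mem_range.1 hl).trans_le hu'
  have hhigh : ∀ l ∈ Finset.Ico u d, l < d := fun l hl => (Finset.mem_Ico.1 hl).2
  refine ⟨fun e he => ?_, fun v => ?_, ?_⟩
  · simp only [exchange, Multiset.mem_add, Multiset.mem_sum] at he
    obtain (he | ⟨l, hl, he⟩) | ⟨l, hl, he⟩ := he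
    exacts [hE e he, hC.not_isDiag (hhigh l hl) he, hC.not_isDiag (hlow l hl) he]
  · simp only [exchange, Multiset.countP_add, countP_sum]
    exact dvd_add (dvd_add (hEr v) (Finset.dvd_sum fun l hl => hC.dvd_countP i l (hhigh l hl) v))
      (Finset.dvd_sum fun l hl => hC.dvd_countP (i + 1) l (hlow l hl) v)
  · have hnext : ∑ l ∈ Finset.range u', Multiset.card (C (i + 1) l) = u' * (g * (1 + D)) := by
      rcases (show i + 1 ≤ q from hi).eq_or_lt with hiq | hiq
      · simp [hiu' hiq]
      · rw [Finset.sum_congr rfl fun l hl => hC.card_eq (i + 1) hiq l (hlow l hl)]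
        simp
    have hcard : Multiset.card (exchange C d i (E, u, u')) =
        g * (n + (d - u) + u') + D * (g * (d - u + u')) := by
      simp only [exchange, Multiset.card_add, Multiset.card_sum, Finset.card_val, hn, hnext]
      rw [Finset.sum_congr rfl fun l hl => hC.card_eq i hi l (hhigh l hl), Finset.sum_const,
        Nat.card_Ico, smul_eq_mul]
      ring
    rw [hcard]
    refine dvd_add ?_ (dvd_mul_right _ _)
    rw [hD]
    exact mul_dvd_mul_left g hd

theorem exists_balancing_heights {n : ℕ → ℕ} (hd : 0 < d) (hn : d ∣ ∑ i ∈ Finset.range q, n i) :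
    ∃ u : ℕ → ℕ, u 0 = 0 ∧ u q = 0 ∧ (∀ i, u i < d) ∧
      ∀ i < q, d ∣ n i + (d - u i) + u (i + 1) := by
  refine ⟨fun i => (∑ j ∈ Finset.Ico i q, n j) % d, ?_, by simp, fun i => Nat.mod_lt _ hd,
    fun i hi => ?_⟩
  · simpa using Nat.mod_eq_zero_of_dvd hn
  · dsimp only
    rw [Finset.sum_eq_sum_Ico_succ_bot hi]
    set y := ∑ j ∈ Finset.Ico (i + 1) q, n j
    have hlt := Nat.mod_lt (n i + y) hd
    have hmod : (n i + y % d) % d = (n i + y) % d := Nat.add_mod_mod ..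
    have hdiv := Nat.mod_add_div (n i + y % d) d
    refine ⟨(n i + y % d) / d + 1, ?_⟩
    rw [mul_add, mul_one]
    omega

theorem card_sym2_le_mul_self {S : Finset V} {m : ℕ} (hS : S.card ≤ m) :
    S.sym2.card ≤ m * m := by
  rw [Finset.card_sym2, Nat.choose_two_right, Nat.add_sub_cancel]
  refine Nat.div_le_of_le_mul ?_
  linarith [Nat.le_mul_self S.card, Nat.mul_le_mul hS hS]

end Balancing

section Tasks

variable {V : Type*} [Fintype V] {G H : SimpleGraph V} {c : V → ℕ}
  {C : ℕ → ℕ → Multiset (Sym2 V)} {q d r g D B m : ℕ}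

/-- The set of the vertices of colour `i`. -/
def colorClass (c : V → ℕ) (i : ℕ) : Finset V := Finset.univ.filter fun v => c v = i

theorem mem_colorClass {i : ℕ} {v : V} : v ∈ colorClass c i ↔ c v = i := by simp [colorClass]

theorem mem_sym2_colorClass (hH : ∀ u v, H.Adj u v → c u = c v) {e : Sym2 V}
    (he : e ∈ H.edgeFinset) {v : V} (hv : v ∈ e) {i : ℕ} :
    e ∈ (colorClass c i).sym2 ↔ c v = i := by
  obtain ⟨w, rfl⟩ := Sym2.mem_iff_exists.1 hv
  simp [mem_colorClass, hH v w (by simpa using he)]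

theorem sum_edgeFinset_inter_sym2 (hc : ∀ v, c v < q) (hH : ∀ u v, H.Adj u v → c u = c v) :
    ∑ i ∈ Finset.range q, (H.edgeFinset ∩ (colorClass c i).sym2).val = H.edgeFinset.val := by
  refine (Multiset.Nodup.ext (nodup_sum (fun i _ => Finset.nodup _) ?_) (Finset.nodup _)).2 ?_
  · intro i _ j _ e hi hj
    obtain ⟨he, hi⟩ := Finset.mem_inter.1 hi
    exact ((mem_sym2_colorClass hH he e.out_fst_mem).1 hi).symm.trans
      ((mem_sym2_colorClass hH he e.out_fst_mem).1 (Finset.mem_inter.1 hj).2)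
  · intro e
    simp only [Multiset.mem_sum, Finset.mem_val, Finset.mem_inter]
    exact ⟨fun ⟨_, _, he, _⟩ => he, fun he => ⟨c e.out.1, Finset.mem_range.2 (hc _), he,
      (mem_sym2_colorClass hH he e.out_fst_mem).2 rfl⟩⟩

theorem dvd_countP_edgeFinset_inter_sym2 (hH : ∀ u v, H.Adj u v → c u = c v)
    (hr : ∀ v, r ∣ H.degree v) (i : ℕ) (v : V) :
    r ∣ (H.edgeFinset ∩ (colorClass c i).sym2).val.countP fun e => v ∈ e := by
  by_cases hv : c v = i
  · convert hr v using 1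
    rw [← countP_mem_edgeFinset, ← Finset.filter_mem_eq_inter, Finset.filter_val,
      Multiset.countP_filter]
    exact Multiset.countP_congr rfl fun e he => propext
      ⟨And.left, fun h => ⟨h, (mem_sym2_colorClass hH he h).2 hv⟩⟩
  · rw [Multiset.countP_eq_zero.2 fun e he hve => hv ?_]
    · exact dvd_zero r
    · obtain ⟨he, hi⟩ := Finset.mem_inter.1 he
      exact (mem_sym2_colorClass hH he hve).1 hi

/-- The triples `t` for which `exchange C d i t` has to be absorbed. -/
noncomputable def tasks (D r : ℕ) (c : V → ℕ) (C : ℕ → ℕ → Multiset (Sym2 V)) (d i : ℕ) :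
    Finset (Finset (Sym2 V) × ℕ × ℕ) :=
  ((colorClass c i).sym2.powerset ×ˢ Finset.range d ×ˢ Finset.range d).filter fun t =>
    DivisibleEdges D r (exchange C d i t)

theorem exists_subset_tasks_sum_exchange (hC : IsCarrierSystem G r g D q d B C) (hD : D = g * d)
    (hg : 0 < g) (hd : 0 < d) (hgr : ∀ h, r ∣ 2 * h → g ∣ h) (hc : ∀ v, c v < q)
    (hH : ∀ u v, H.Adj u v → c u = c v) (hHD : D ∣ H.edgeFinset.card) (hHr : ∀ v, r ∣ H.degree v) :
    ∃ u ⊆ (Finset.range q).sigma (tasks D r c C d), ∑ t ∈ u, exchange C d t.1 t.2 =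
      H.edgeFinset.val + ∑ i ∈ Finset.range q, ∑ l ∈ Finset.range d, C i l := by
  set E : ℕ → Finset (Sym2 V) := fun i => H.edgeFinset ∩ (colorClass c i).sym2 with hE
  have hEdiag : ∀ i, ∀ e ∈ E i, ¬e.IsDiag := fun i e he =>
    H.not_isDiag_of_mem_edgeSet (SimpleGraph.mem_edgeFinset.1 (Finset.mem_inter.1 he).1)
  have hEr := dvd_countP_edgeFinset_inter_sym2 hH hHr
  have hEg : ∀ i, g ∣ (E i).card := fun i => hgr _ <| by
    rw [← Finset.card_val, ← sum_countP_mem (hEdiag i)]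
    exact Finset.dvd_sum fun v _ => hEr i v
  choose n hn using hEg
  have hsum : ∑ i ∈ Finset.range q, (E i).val = H.edgeFinset.val :=
    sum_edgeFinset_inter_sym2 hc hH
  have hdn : d ∣ ∑ i ∈ Finset.range q, n i := by
    refine Nat.dvd_of_mul_dvd_mul_left hg ?_
    rw [← hD, Finset.mul_sum]
    rwa [← Finset.card_val, ← hsum, Multiset.card_sum,
      Finset.sum_congr rfl fun i _ => (Finset.card_val (E i)).trans (hn i)] at hHD
  obtain ⟨u, hu₀, huq, hud, hu⟩ := exists_balancing_heights hd hdn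
  have htask : ∀ i < q, (E i, u i, u (i + 1)) ∈ tasks D r c C d i := fun i hi =>
    Finset.mem_filter.2 ⟨by simp [hE, hud, Finset.inter_subset_right],
      hC.divisibleEdges_exchange hD hi (hud _).le (fun h => h ▸ huq) (hEdiag i) (hEr i) (hn i)
        (hu i hi)⟩
  refine ⟨(Finset.range q).image fun i => ⟨i, E i, u i, u (i + 1)⟩, fun t ht => ?_, ?_⟩
  · obtain ⟨i, hi, rfl⟩ := Finset.mem_image.1 ht
    exact Finset.mem_sigma.2 ⟨hi, htask i (Finset.mem_range.1 hi)⟩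
  · rw [Finset.sum_image fun i _ j _ h => congrArg Sigma.fst h, ← hsum]
    exact sum_exchange E (fun i => (hud i).le) hu₀ huq

theorem card_tasks_le {i : ℕ} (hm : (colorClass c i).card ≤ m) :
    (tasks D r c C d i).card ≤ 2 ^ (m * m) * (d * d) := by
  refine (Finset.card_filter_le _ _).trans ?_
  rw [Finset.card_product, Finset.card_product, Finset.card_powerset, Finset.card_range]
  gcongr
  · exact one_le_two
  · exact card_sym2_le_mul_self hm

theorem card_exchange_le {w i : ℕ} {t : Finset (Sym2 V) × ℕ × ℕ} (ht : t ∈ tasks D r c C d i)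
    (hm : (colorClass c i).card ≤ m) (hC : ∀ i, ∀ l < d, Multiset.card (C i l) ≤ w) :
    Multiset.card (exchange C d i t) ≤ m * m + 2 * (d * w) := by
  have ht := (Finset.mem_filter.1 ht).1
  simp only [Finset.mem_product, Finset.mem_powerset, Finset.mem_range] at ht
  have hlow : ∑ l ∈ Finset.range t.2.2, Multiset.card (C (i + 1) l) ≤ d * w :=
    (Finset.sum_le_card_nsmul _ _ w fun l hl =>
      hC (i + 1) l ((Finset.mem_range.1 hl).trans ht.2.2)).trans
      (by rw [Finset.card_range, smul_eq_mul]; exact Nat.mul_le_mul_right w ht.2.2.le)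
  have hhigh : ∑ l ∈ Finset.Ico t.2.1 d, Multiset.card (C i l) ≤ d * w :=
    (Finset.sum_le_card_nsmul _ _ w fun l hl => hC i l (Finset.mem_Ico.1 hl).2).trans
      (by rw [Nat.card_Ico, smul_eq_mul]; exact Nat.mul_le_mul_right w (Nat.sub_le d _))
  simp only [exchange, Multiset.card_add, Multiset.card_sum, Finset.card_val]
  linarith [(Finset.card_le_card ht.1).trans (card_sym2_le_mul_self hm)]

theorem mem_supp_exchange {i : ℕ} {t : Finset (Sym2 V) × ℕ × ℕ} (ht : t ∈ tasks D r c C d i)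
    {v : V} (hv : v ∈ supp (exchange C d i t)) :
    c v = i ∨ v ∈ supp (∑ l ∈ Finset.range d, C i l) ∨
      v ∈ supp (∑ l ∈ Finset.range d, C (i + 1) l) := by
  have ht := (Finset.mem_filter.1 ht).1
  simp only [Finset.mem_product, Finset.mem_powerset, Finset.mem_range] at ht
  obtain ⟨e, he, hve⟩ := mem_supp.1 hv
  simp only [exchange, Multiset.mem_add, Multiset.mem_sum] at he
  simp only [mem_supp, Multiset.mem_sum]
  obtain (he | ⟨l, hl, he⟩) | ⟨l, hl, he⟩ := he
  · exact Or.inl (mem_colorClass.1 (Finset.mem_sym2_iff.1 (ht.1 he) v hve))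
  · exact Or.inr (Or.inl ⟨e, ⟨l, Finset.mem_range.2 (Finset.mem_Ico.1 hl).2, he⟩, hve⟩)
  · exact Or.inr (Or.inr ⟨e, ⟨l, Finset.mem_range.2 ((Finset.mem_range.1 hl).trans ht.2.2), he⟩,
      hve⟩)

theorem IsCarrierSystem.card_filter_mem_supp_le (hC : IsCarrierSystem G r g D q d B C) (v : V) :
    ((Finset.range q).filter fun i => c v = i ∨ v ∈ supp (∑ l ∈ Finset.range d, C i l) ∨
      v ∈ supp (∑ l ∈ Finset.range d, C (i + 1) l)).card ≤ 1 + 2 * B := by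
  have hcur : ((Finset.range q).filter fun i => v ∈ supp (∑ l ∈ Finset.range d, C i l)).card ≤ B :=
    (GraphDecomp.card_filter_mem_supp_le _ _ v).trans (hC.countP_le v)
  have hnext : ((Finset.range q).filter fun i =>
      v ∈ supp (∑ l ∈ Finset.range d, C (i + 1) l)).card ≤ B := by
    refine (Finset.card_le_card_of_injOn (· + 1) (fun i hi => ?_)
      (add_left_injective 1).injOn).trans hcur
    have hi := (Finset.mem_filter.1 hi).2
    refine Finset.mem_filter.2 ⟨Finset.mem_range.2 (not_le.1 fun hq => ?_), hi⟩
    simp [hC.eq_zero _ _ hq, mem_supp] at hi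
  have hcolor : ((Finset.range q).filter fun i => c v = i).card ≤ 1 :=
    Finset.card_le_one.2 fun i hi j hj =>
      (Finset.mem_filter.1 hi).2.symm.trans (Finset.mem_filter.1 hj).2
  rw [Finset.filter_or, Finset.filter_or]
  refine (Finset.card_union_le _ _).trans
    ((Nat.add_le_add hcolor (Finset.card_union_le _ _)).trans ?_)
  linarith

theorem card_filter_mem_supp_exchange_le (hC : IsCarrierSystem G r g D q d B C) {M : ℕ}
    (hM : ∀ i, (tasks D r c C d i).card ≤ M) (v : V) :
    (((Finset.range q).sigma (tasks D r c C d)).filter fun t =>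
      v ∈ supp (exchange C d t.1 t.2)).card ≤ (1 + 2 * B) * M := by
  refine (Finset.card_le_card (t := ((Finset.range q).filter fun i =>
    c v = i ∨ v ∈ supp (∑ l ∈ Finset.range d, C i l) ∨
      v ∈ supp (∑ l ∈ Finset.range d, C (i + 1) l)).sigma (tasks D r c C d))
    fun t ht => ?_).trans ?_
  · obtain ⟨ht, hv⟩ := Finset.mem_filter.1 ht
    obtain ⟨hi, ht⟩ := Finset.mem_sigma.1 ht
    exact Finset.mem_sigma.2 ⟨Finset.mem_filter.2 ⟨hi, mem_supp_exchange ht hv⟩, ht⟩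
  · rw [Finset.card_sigma]
    exact (Finset.sum_le_card_nsmul _ _ M fun i _ => hM i).trans
      (Nat.mul_le_mul_right M (hC.card_filter_mem_supp_le v))

end Tasks

section Assembly

variable {W V : Type*} [Fintype W] [Fintype V] {F : SimpleGraph W} {G : SimpleGraph V}
  {c : V → ℕ} {C : ℕ → ℕ → Multiset (Sym2 V)} {E : Multiset (Sym2 V)}
  {r g q d a b h m k θ B K M : ℕ}

theorem exists_isCarrierSystem (hF : F.IsRegularOfDegree r) {x y : W} (hxy : F.Adj x y)
    (hg : r ∣ 2 * g) (hgr : g ≤ r) (q d : ℕ) (hK : 1 + g * Fintype.card W ≤ K)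
    (hG : ∀ v, Fintype.card V ≤ G.degree v + a)
    (hV : 3 * r * (a + (1 + K)) + b ≤ Fintype.card V) (hb : 2 * (q * d * K ^ 2) + K ≤ b) :
    ∃ C, IsCarrierSystem G r g F.edgeFinset.card q d (1 + K) C := by
  obtain ⟨T, hT⟩ := exists_isEdgeDisjointFamily (s := Finset.range q ×ˢ Finset.range d)
    (R := fun _ => ∅) (θ := 1) (ρ := 0) (k := 1 + g * Fintype.card W) hG (fun _ _ => by simpa)
    (fun v => by simp) one_pos (by simpa using hV) (by simpa using hb)
    fun _ _ G' hG' => hasFreshEdges_carrier hF hG' hxy hg hgr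
  have hsum : ∑ i ∈ Finset.range q, ∑ l ∈ Finset.range d, (if i < q then T (i, l) else 0) =
      ∑ p ∈ Finset.range q ×ˢ Finset.range d, T p := by
    rw [Finset.sum_product]
    exact Finset.sum_congr rfl fun i hi => by simp [Finset.mem_range.1 hi]
  have hprop : ∀ i < q, ∀ l < d, _ := fun i hi l hl => hT.prop (i, l) (by simp [hi, hl])
  refine ⟨fun i l => if i < q then T (i, l) else 0, fun i l hi => if_neg hi.not_gt,
    fun i l hl v => ?_, fun i hi l hl => ?_, hsum ▸ hT.nodup, hsum ▸ hT.mem_edgeSet, fun v => ?_⟩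
  · split_ifs with hi
    · exact (hprop i hi l hl).1 v
    · simp
  · rw [if_pos hi]
    exact (hprop i hi l hl).2
  · rw [hsum]
    simpa using hT.countP_le v

/-- The edge set `E` of `G`, with degrees at most `k`, is absorbing: together with any `F`-divisible
graph all of whose edges are inside the colour classes of `c`, it decomposes into copies of `F`. -/
structure IsAbsorbing (F : SimpleGraph W) (G : SimpleGraph V) (c : V → ℕ) (k : ℕ)
    (E : Multiset (Sym2 V)) : Prop where
  nodup : E.Nodup
  mem_edgeSet : ∀ e ∈ E, e ∈ G.edgeSet
  countP_le : ∀ v, E.countP (fun e => v ∈ e) ≤ k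
  add_mem_decomposable : ∀ H : SimpleGraph V, IsDivisible F H → (∀ u v, H.Adj u v → c u = c v) →
    E + H.edgeFinset.val ∈ decomposable F V

theorem IsCarrierSystem.exists_absorbers [Nonempty W]
    (hC : IsCarrierSystem G r g F.edgeFinset.card q d B C) (hF : F.IsRegularOfDegree r)
    (hr : 0 < r) (hm : ∀ i, (colorClass c i).card ≤ m)
    (hM : ∀ i, (tasks F.edgeFinset.card r c C d i).card ≤ M)
    (hh : m * m + 2 * (d * (g * (1 + F.edgeFinset.card))) ≤ h)
    (hK : 2 * h + absorberCost r (Fintype.card W) F.edgeFinset.card h ≤ K)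
    (hG : ∀ v, Fintype.card V ≤ G.degree v + a) (hθ : 0 < θ)
    (hV : 3 * r * (a + B + (θ + K * ((1 + 2 * B) * M + 1))) + b ≤ Fintype.card V)
    (hb : 2 * (q * M * K ^ 2) / θ + K ≤ b) :
    ∃ T, IsEdgeDisjointFamily
      (G.deleteEdges {e | e ∈ ∑ i ∈ Finset.range q, ∑ l ∈ Finset.range d, C i l})
      (fun t => supp (exchange C d t.1 t.2))
      (fun t T => T + exchange C d t.1 t.2 ∈ decomposable F V ∧ T ∈ decomposable F V) θ K
      ((Finset.range q).sigma (tasks F.edgeFinset.card r c C d)) T := by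
  have hCw : ∀ i, ∀ l < d, Multiset.card (C i l) ≤ g * (1 + F.edgeFinset.card) :=
    fun i l hl => by
      rcases lt_or_ge i q with hi | hi
      · exact (hC.card_eq i hi l hl).le
      · simp [hC.eq_zero i l hi]
  have hcard : ((Finset.range q).sigma (tasks F.edgeFinset.card r c C d)).card ≤ q * M := by
    rw [Finset.card_sigma]
    simpa using Finset.sum_le_card_nsmul (Finset.range q) _ M fun i _ => hM i
  obtain ⟨G', hG'⟩ : ∃ G', G' =
      G.deleteEdges {e | e ∈ ∑ i ∈ Finset.range q, ∑ l ∈ Finset.range d, C i l} := ⟨_, rfl⟩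
  have hdeg : ∀ v, Fintype.card V ≤ G'.degree v + (a + B) := fun v => by
    have := degree_le_degree_add (G' := G') (fun v w hvw he =>
      hG' ▸ SimpleGraph.deleteEdges_adj.2 ⟨hvw, he⟩) hC.countP_le v
    linarith [hG v]
  rw [← hG']
  exact GraphDecomp.exists_absorbers (s := (Finset.range q).sigma (tasks F.edgeFinset.card r c C d))
    (P := fun t => exchange C d t.1 t.2) (a := a + B) hF hr
    (fun t ht => (Finset.mem_filter.1 (Finset.mem_sigma.1 ht).2).2)
    (fun t ht => (card_exchange_le (Finset.mem_sigma.1 ht).2 (hm _) hCw).trans hh)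
    (card_filter_mem_supp_exchange_le hC hM) hK hdeg hθ hV (le_trans (by gcongr) hb)

theorem IsCarrierSystem.isAbsorbing (hC : IsCarrierSystem G r g F.edgeFinset.card q d B C)
    (hF : F.IsRegularOfDegree r) (hD : F.edgeFinset.card = g * d) (hg : 0 < g) (hd : 0 < d)
    (hgr : ∀ h, r ∣ 2 * h → g ∣ h) (hc : ∀ v, c v < q)
    (hM : ∀ i, (tasks F.edgeFinset.card r c C d i).card ≤ M)
    {T : (Σ _ : ℕ, Finset (Sym2 V) × ℕ × ℕ) → Multiset (Sym2 V)}
    (hT : IsEdgeDisjointFamily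
      (G.deleteEdges {e | e ∈ ∑ i ∈ Finset.range q, ∑ l ∈ Finset.range d, C i l})
      (fun t => supp (exchange C d t.1 t.2))
      (fun t T => T + exchange C d t.1 t.2 ∈ decomposable F V ∧ T ∈ decomposable F V) θ K
      ((Finset.range q).sigma (tasks F.edgeFinset.card r c C d)) T) :
    IsAbsorbing F G c (B + (θ + K * ((1 + 2 * B) * M + 1)))
      (∑ i ∈ Finset.range q, ∑ l ∈ Finset.range d, C i l +
        ∑ t ∈ (Finset.range q).sigma (tasks F.edgeFinset.card r c C d), T t) := by
  have hTG : ∀ e ∈ ∑ t ∈ (Finset.range q).sigma (tasks F.edgeFinset.card r c C d), T t,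
      e ∈ G.edgeSet ∧ e ∉ ∑ i ∈ Finset.range q, ∑ l ∈ Finset.range d, C i l := fun e he => by
    simpa only [SimpleGraph.edgeSet_deleteEdges, Set.mem_sdiff, Set.mem_ofPred_eq]
      using hT.mem_edgeSet e he
  refine ⟨?_, ?_, fun v => ?_, fun H hH hHc => ?_⟩
  · exact Multiset.nodup_add.2
      ⟨hC.nodup, hT.nodup, Multiset.disjoint_right.2 fun {e} he => (hTG e he).2⟩
  · exact fun e he => (Multiset.mem_add.1 he).elim (hC.mem_edgeSet e) fun he => (hTG e he).1
  · rw [Multiset.countP_add]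
    exact Nat.add_le_add (hC.countP_le v) ((hT.countP_le v).trans
      (by gcongr; exact card_filter_mem_supp_exchange_le hC hM v))
  · obtain ⟨u, hu, hsum⟩ := exists_subset_tasks_sum_exchange hC hD hg hd hgr hc hHc hH.1
      (hH.dvd_degree hF)
    convert sum_add_sum_mem_decomposable (fun t ht => (hT.prop t ht).2)
      (fun t ht => (hT.prop t ht).1) hu using 1
    rw [hsum]
    abel

theorem IsAbsorbing.exists_graph (hE : IsAbsorbing F G c k E)
    (hc : ∀ u v, G.Adj u v → c u ≠ c v) :
    ∃ A ≤ G, IsDivisible F A ∧ (∀ v, A.degree v ≤ k) ∧ ∀ H : SimpleGraph V, IsDivisible F H →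
      (∀ u v, H.Adj u v → c u = c v) → HasDecomposition F (A ⊔ H) := by
  obtain ⟨A, hA⟩ : ∃ A : SimpleGraph V, A.edgeFinset.val = E := by
    refine ⟨SimpleGraph.fromEdgeSet {e | e ∈ E},
      (Multiset.Nodup.ext (Finset.nodup _) hE.nodup).2 fun e => ?_⟩
    simpa using fun he => G.not_isDiag_of_mem_edgeSet (hE.mem_edgeSet e he)
  have hAG : A ≤ G := SimpleGraph.edgeSet_subset_edgeSet.1 fun e he =>
    hE.mem_edgeSet e (hA ▸ SimpleGraph.mem_edgeFinset.2 he)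
  refine ⟨A, hAG, ?_, fun v => ?_, fun H hH hHc => ?_⟩
  · obtain ⟨Z, hZ⟩ : ∃ Z : SimpleGraph V, Z.edgeFinset.val = 0 := ⟨⊥, by simp⟩
    have h := hE.add_mem_decomposable Z
      (isDivisible_of_mem_decomposable (by rw [hZ]; exact zero_mem _)) fun u v huv =>
        absurd (SimpleGraph.mem_edgeFinset.2 huv : s(u, v) ∈ Z.edgeFinset.val)
          (by rw [← Finset.mem_val, hZ]; exact Multiset.notMem_zero _)
    exact isDivisible_of_mem_decomposable (by rwa [hZ, add_zero, ← hA] at h)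
  · rw [← countP_mem_edgeFinset, hA]
    exact hE.countP_le v
  · have hdisj : Disjoint A.edgeFinset.val H.edgeFinset.val :=
      Multiset.disjoint_left.2 fun {e} he he' => by
        induction e with
        | _ u v => exact hc u v (hAG (by simpa using he)) (hHc u v (by simpa using he'))
    refine hasDecomposition_of_mem_decomposable ?_
    convert hE.add_mem_decomposable H hH hHc using 1
    rw [← hA]
    refine (Multiset.Nodup.ext (Finset.nodup _)
      (Multiset.nodup_add.2 ⟨Finset.nodup _, Finset.nodup _, hdisj⟩)).2 fun e => ?_
    simp

end Assembly

section Parameters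

/-- A bound on the size of the carriers, for `r`-regular graphs on `f` vertices. -/
def carrierCost (r f : ℕ) : ℕ := 1 + r * f

/-- A bound on the number of edges of the exchanges at a colour class of size at most `m`. -/
def exchangeCost (r f m : ℕ) : ℕ := m * m + 2 * (r * f * (r * (1 + r * f)))

/-- A bound on the number of exchanges at a colour class of size at most `m`. -/
def taskCount (r f m : ℕ) : ℕ := 2 ^ (m * m) * (r * f * (r * f))

/-- A bound on the size of the absorbers of the exchanges at a colour class of size at most `m`. -/
def gadgetCost (r f m : ℕ) : ℕ :=
  2 * exchangeCost r f m + absorberCost r f (r * f) (exchangeCost r f m)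

/-- The part of the degree bound for the absorbing graph that does not depend on the number of
vertices. -/
def overhead (r f m : ℕ) : ℕ :=
  1 + carrierCost r f +
    gadgetCost r f m * ((1 + 2 * (1 + carrierCost r f)) * taskCount r f m + 1)

/-- The number of vertices from which on the absorbing graph exists and has degrees at most `1 / t²`
times the number of vertices. -/
def sizeBound (r f t m : ℕ) : ℕ :=
  m + 2 * t ^ 2 * (overhead r f m + 4 * t * (taskCount r f m * gadgetCost r f m ^ 2) + 1)

variable {W V : Type*} [Fintype W] [Fintype V] {F : SimpleGraph W} {G : SimpleGraph V}
  {c : V → ℕ} {r q t a b k m n θ : ℕ}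

theorem two_mul_card_edgeFinset (hF : F.IsRegularOfDegree r) :
    2 * F.edgeFinset.card = r * Fintype.card W := by
  rw [← F.sum_degrees_eq_twice_card_edges, Finset.sum_congr rfl fun v _ => hF v]
  simp [mul_comm]

theorem exists_isAbsorbing [Nonempty W] (hF : F.IsRegularOfDegree r) (hr : 0 < r)
    (hc : ∀ v, c v < q) (hm : ∀ i, (colorClass c i).card ≤ m)
    (hG : ∀ v, Fintype.card V ≤ G.degree v + a) (hθ : 0 < θ)
    (hV : 3 * r * (a + (θ + overhead r (Fintype.card W) m)) + b ≤ Fintype.card V)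
    (hb₁ : 2 * (q * (r * Fintype.card W) * carrierCost r (Fintype.card W) ^ 2) +
      overhead r (Fintype.card W) m ≤ b)
    (hb₂ : 2 * (q * taskCount r (Fintype.card W) m * gadgetCost r (Fintype.card W) m ^ 2) / θ +
      overhead r (Fintype.card W) m ≤ b) :
    ∃ E, IsAbsorbing F G c (θ + overhead r (Fintype.card W) m) E := by
  obtain ⟨f, hf⟩ : ∃ f, Fintype.card W = f := ⟨_, rfl⟩
  obtain ⟨x⟩ := ‹Nonempty W›
  obtain ⟨y, hxy⟩ := (F.degree_pos_iff_exists_adj x).1 (by rwa [hF x])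
  obtain ⟨g, hg, hgr, hdvd, hmin⟩ := exists_dvd_two_mul_forall_dvd hr
  have hsum : 2 * F.edgeFinset.card = r * f := hf ▸ two_mul_card_edgeFinset hF
  have hpos : 0 < F.edgeFinset.card := Finset.card_pos.2 ⟨s(x, y), by simpa using hxy⟩
  obtain ⟨d, hd⟩ := hmin _ ⟨f, hsum⟩
  have hd₀ : 0 < d := pos_of_mul_pos_right (hd ▸ hpos) g.zero_le
  have hD : F.edgeFinset.card ≤ r * f := by omega
  have hdf : d ≤ r * f := (Nat.le_mul_of_pos_left d hg).trans (hd ▸ hD)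
  simp only [hf] at hV hb₁ hb₂ ⊢
  have hcarrier : 1 + carrierCost r f ≤ overhead r f m := Nat.le_add_right _ _
  have hgadget : gadgetCost r f m ≤ overhead r f m :=
    (Nat.le_mul_of_pos_right _ (Nat.succ_pos _)).trans (Nat.le_add_left _ _)
  obtain ⟨C, hC⟩ := exists_isCarrierSystem (G := G) (a := a) (b := b) (K := carrierCost r f)
    hF hxy hdvd hgr q d (by rw [hf, carrierCost]; gcongr) hG
    (le_trans (by gcongr <;> omega) hV)
    (le_trans (by gcongr; exact le_of_add_le_right hcarrier) hb₁)
  have hM : ∀ i, (tasks F.edgeFinset.card r c C d i).card ≤ taskCount r f m := fun i =>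
    (card_tasks_le (hm i)).trans (by rw [taskCount]; gcongr)
  obtain ⟨T, hT⟩ := hC.exists_absorbers (a := a) (b := b) (h := exchangeCost r f m)
    (K := gadgetCost r f m) (M := taskCount r f m) (θ := θ) hF hr hm hM
    (by rw [exchangeCost]; gcongr)
    (by rw [hf, gadgetCost]; gcongr; exact absorberCost_le_absorberCost _ _ hD le_rfl)
    hG hθ (by rw [overhead] at hV; convert hV using 3; ring)
    (le_trans (by gcongr) hb₂)
  refine ⟨∑ i ∈ Finset.range q, ∑ l ∈ Finset.range d, C i l +
    ∑ t ∈ (Finset.range q).sigma (tasks F.edgeFinset.card r c C d), T t, ?_⟩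
  convert hC.isAbsorbing hF hd hg hd₀ hmin hc hM hT using 1
  rw [overhead]
  ring

theorem exists_degree_threshold {κ l μ : ℕ} (ht : 0 < t) (hm : 4 * t * l ≤ m) (hm₀ : 0 < m)
    (hn : m + 2 * t ^ 2 * (κ + 4 * t * μ + 1) ≤ n) (hq : q * m ≤ n + m) :
    ∃ θ, 0 < θ ∧ (θ + κ) * t ^ 2 ≤ n ∧ 2 * (q * l) + κ ≤ n / t ∧ 2 * (q * μ) / θ + κ ≤ n / t := by
  have hn' : m + 2 * (t ^ 2 * κ) + 8 * (t ^ 3 * μ) + 2 * t ^ 2 ≤ n := by linarith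
  have hκ : t * κ ≤ t ^ 2 * κ := Nat.mul_le_mul_right _ (Nat.le_self_pow two_ne_zero t)
  have hθ : n < t ^ 2 * (n / t ^ 2 + 1) := Nat.lt_mul_div_succ n (pow_pos ht 2)
  have hle : κ + 1 ≤ n / t ^ 2 := by
    rw [Nat.le_div_iff_mul_le (pow_pos ht 2)]
    linarith [(t ^ 2 * κ).zero_le, (t ^ 3 * μ).zero_le]
  obtain ⟨θ, hθn⟩ := Nat.exists_eq_add_of_le' (Nat.le_of_succ_le hle)
  rw [hθn] at hθ hle
  have hθ₂ : n ≤ 2 * t ^ 2 * θ := by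
    linarith [(t ^ 3 * μ).zero_le]
  refine ⟨θ, by omega, hθn ▸ Nat.div_mul_le_self n _, ?_, ?_⟩
  · rw [Nat.le_div_iff_mul_le ht]
    have h : q * (4 * t * l) ≤ n + m := (Nat.mul_le_mul_left q hm).trans hq
    linarith [(t ^ 3 * μ).zero_le, (t ^ 2).zero_le]
  · have hβ : 2 * (q * μ) / θ ≤ 8 * t ^ 2 * μ := by
      have hqn : q ≤ 2 * n := (Nat.le_mul_of_pos_right q hm₀).trans (by omega)
      refine Nat.div_le_of_le_mul ?_
      calc 2 * (q * μ) ≤ 2 * ((2 * (2 * t ^ 2 * θ)) * μ) := by gcongr; omega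
        _ = θ * (8 * t ^ 2 * μ) := by ring
    refine (Nat.add_le_add_right hβ κ).trans ((Nat.le_div_iff_mul_le ht).2 ?_)
    linarith [(t ^ 2 * κ).zero_le, (t ^ 2).zero_le]

theorem three_mul_add_div_le (hr : 0 < r) (ht : 2 ≤ t) (ha : (a : ℝ) ≤ n / (3 * r) - n / t)
    (hk : k * t ^ 2 ≤ n) : 3 * r * (a + k) + n / t ≤ n := by
  have hr' : (1 : ℝ) ≤ r := by exact_mod_cast hr
  have ht' : (2 : ℝ) ≤ t := by exact_mod_cast ht
  have hk' : (k : ℝ) ≤ n / t / 2 := by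
    rw [div_div, le_div_iff₀ (by positivity)]
    calc (k : ℝ) * (t * 2) ≤ k * t ^ 2 := by rw [sq]; gcongr
      _ ≤ n := by exact_mod_cast hk
  have hdiv : ((n / t : ℕ) : ℝ) ≤ r * (n / t) :=
    Nat.cast_div_le.trans (le_mul_of_one_le_left (by positivity) hr')
  have key : 3 * r * (a + k) + ((n / t : ℕ) : ℝ) ≤ n := by
    calc 3 * r * (a + k) + ((n / t : ℕ) : ℝ)
        ≤ 3 * r * (n / (3 * r) - n / t + n / t / 2) + r * (n / t) := by gcongr
      _ = n - r * (n / t) / 2 := by field_simp; ring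
      _ ≤ n := sub_le_self _ (by positivity)
  exact_mod_cast key

end Parameters

section Crossing

variable {W V : Type*} [Fintype W] [Fintype V] {F : SimpleGraph W} {G : SimpleGraph V}
  {c : V → ℕ} {r t q a m n k : ℕ}

theorem exists_absorbing_graph [Nonempty W] (hF : F.IsRegularOfDegree r) (hr : 0 < r) (ht : 2 ≤ t)
    (hm₀ : 0 < m) (hm : 4 * t * (r * Fintype.card W * carrierCost r (Fintype.card W) ^ 2) ≤ m)
    (hn : sizeBound r (Fintype.card W) t m ≤ Fintype.card V)
    (hq : q * m ≤ Fintype.card V + m) (hc : ∀ v, c v < q) (hcm : ∀ i, (colorClass c i).card ≤ m)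
    (hcG : ∀ u v, G.Adj u v → c u ≠ c v)
    (hG : (1 - 1 / (3 * (r : ℝ)) + 1 / t) * Fintype.card V ≤ G.minDegree) :
    ∃ A ≤ G, IsDivisible F A ∧ A.maxDegree * t ^ 2 ≤ Fintype.card V ∧
      ∀ H : SimpleGraph V, IsDivisible F H → (∀ u v, H.Adj u v → c u = c v) →
        HasDecomposition F (A ⊔ H) := by
  have hle : G.minDegree ≤ Fintype.card V := by
    cases isEmpty_or_nonempty V
    · simp
    · exact G.minDegree_lt_card.le
  have ha : ((Fintype.card V - G.minDegree : ℕ) : ℝ) ≤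
      Fintype.card V / (3 * r) - Fintype.card V / t := by
    rw [Nat.cast_sub hle]
    linear_combination hG
  obtain ⟨θ, hθ, hθn, hb₁, hb₂⟩ := exists_degree_threshold (by omega) hm hm₀ hn hq
  obtain ⟨E, hE⟩ := exists_isAbsorbing (G := G) hF hr hc hcm
    (fun v => by have := G.minDegree_le_degree v; omega) hθ (three_mul_add_div_le hr ht ha hθn)
    (by simpa only [mul_assoc] using hb₁) (by simpa only [mul_assoc] using hb₂)
  obtain ⟨A, hAG, hA, hdeg, hH⟩ := hE.exists_graph hcG
  have hmax := A.maxDegree_le_of_forall_degree_le _ hdeg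
  exact ⟨A, hAG, hA, (Nat.mul_le_mul_right _ hmax).trans hθn, hH⟩

theorem exists_coloring (P : Finpartition (Finset.univ : Finset V))
    (hP : ∀ S ∈ P.parts, S.card ≤ m) :
    ∃ c : V → ℕ, (∀ v, c v < P.parts.card) ∧ (∀ i, (colorClass c i).card ≤ m) ∧
      ∀ u v, c u = c v ↔ P.part u = P.part v := by
  have hpart : ∀ v, P.part v ∈ P.parts := fun v => P.part_mem.2 (Finset.mem_univ v)
  have hiff : ∀ u v, (P.parts.equivFin ⟨P.part u, hpart u⟩ : ℕ) =
      P.parts.equivFin ⟨P.part v, hpart v⟩ ↔ P.part u = P.part v := by simp [Fin.val_inj]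
  refine ⟨fun v => P.parts.equivFin ⟨P.part v, hpart v⟩, fun v => Fin.is_lt _, fun i => ?_, hiff⟩
  obtain h | ⟨v, hv⟩ := (colorClass (fun v => (P.parts.equivFin ⟨P.part v, hpart v⟩ : ℕ))
    i).eq_empty_or_nonempty
  · simp [h]
  · refine (Finset.card_le_card fun u hu => ?_).trans (hP _ (hpart v))
    rw [← (hiff u v).1 ((mem_colorClass.1 hu).trans (mem_colorClass.1 hv).symm)]
    exact P.mem_part (Finset.mem_univ u)

theorem crossing_le (P : Finpartition (Finset.univ : Finset V)) : crossing P G ≤ G :=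
  fun _ _ h => h.1

theorem maxDegree_induce_eq_zero_of_le_crossing {P : Finpartition (Finset.univ : Finset V)}
    {A : SimpleGraph V} (hA : A ≤ crossing P G) {S : Finset V} (hS : S ∈ P.parts) :
    (A.induce (S : Set V)).maxDegree = 0 := by
  refine Nat.le_zero.1 (SimpleGraph.maxDegree_le_of_forall_degree_le _ _ fun v => ?_)
  refine ((SimpleGraph.degree_eq_zero _ _).2 fun u huv => ?_).le
  exact (hA huv).2 <| (P.part_eq_of_mem hS v.2).trans (P.part_eq_of_mem hS u.2).symm

theorem exists_absorbing_graph_le_crossing [Nonempty W]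
    {P : Finpartition (Finset.univ : Finset V)} (hF : F.IsRegularOfDegree r) (hr : 0 < r)
    (ht : 2 ≤ t) (hm₀ : 0 < m)
    (hm : 4 * t * (r * Fintype.card W * carrierCost r (Fintype.card W) ^ 2) ≤ m)
    (hn : sizeBound r (Fintype.card W) t m ≤ Fintype.card V)
    (hq : (P.parts.card : ℝ) ≤ Fintype.card V / m + 1) (hP : ∀ S ∈ P.parts, S.card ≤ m)
    (hG : (1 - 1 / (3 * (r : ℝ)) + 1 / t) * Fintype.card V ≤ (crossing P G).minDegree) :
    ∃ A ≤ crossing P G, IsDivisible F A ∧ A.maxDegree * t ^ 2 ≤ Fintype.card V ∧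
      ∀ H : SimpleGraph V, IsDivisible F H → crossing P H = ⊥ → HasDecomposition F (A ⊔ H) := by
  obtain ⟨c, hc, hcm, hcP⟩ := exists_coloring P hP
  obtain ⟨G₀, hG₀⟩ : ∃ G₀, G₀ = crossing P G := ⟨_, rfl⟩
  rw [← hG₀] at hG ⊢
  have hqm : P.parts.card * m ≤ Fintype.card V + m := by
    have hm' : (0 : ℝ) < m := by exact_mod_cast hm₀
    rw [← div_add_same hm'.ne', le_div_iff₀ hm'] at hq
    exact_mod_cast hq
  obtain ⟨A, hAG, hA, hdeg, hAH⟩ := exists_absorbing_graph hF hr ht hm₀ hm hn hqm hc hcm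
    (fun u v h => (hcP u v).not.2 (hG₀ ▸ h : (crossing P G).Adj u v).2) hG
  refine ⟨A, hAG, hA, hdeg, fun H hH hPH => hAH H hH fun u v huv => (hcP u v).2 ?_⟩
  by_contra hne
  exact (hPH ▸ ⟨huv, hne⟩ : (⊥ : SimpleGraph V).Adj u v)

end Crossing

end GraphDecomp

open GraphDecomp in
theorem lemma7p1_general :
    ∃ n₀ : ℕ → ℕ, ∀ (r f : ℕ) (ε : ℝ), 1 ≤ r → 1 ≤ f → 0 < ε →
      ∃ m₀ : ℕ, ∀ m : ℕ, m₀ ≤ m → ∀ n : ℕ, n₀ m ≤ n →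
        ∀ (W : Type*) [Fintype W] (F : SimpleGraph W),
          Fintype.card W = f → F.IsRegularOfDegree r →
        ∀ (V : Type*) [Fintype V] (G : SimpleGraph V), Fintype.card V = n →
        ∀ P : Finpartition (Finset.univ : Finset V),
          (P.parts.card : ℝ) ≤ n / m + 1 →
          (∀ S ∈ P.parts, S.card ≤ m) →
          (1 - 1 / (3 * (r : ℝ)) + ε) * n ≤ (crossing P G).minDegree →
          ∃ A ≤ crossing P G, IsDivisible F A ∧ (A.maxDegree : ℝ) ≤ ε ^ 2 * n ∧
            ∀ H : SimpleGraph V, IsDivisible F H → crossing P H = ⊥ →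
              HasDecomposition F (A ⊔ H) := by
  refine ⟨fun m => (Finset.range (m + 1) ×ˢ Finset.range (m + 1) ×ˢ Finset.range (m + 1)).sup
    fun p => sizeBound p.1 p.2.1 p.2.2 m, fun r f ε hr hf hε => ?_⟩
  obtain ⟨t, ht, htε⟩ : ∃ t : ℕ, 2 ≤ t ∧ 1 / (t : ℝ) ≤ ε := by
    obtain ⟨t, ht⟩ := exists_nat_one_div_lt hε
    refine ⟨t + 2, by omega, le_trans ?_ ht.le⟩
    push_cast
    gcongr
    norm_num
  refine ⟨r + f + t + 4 * t * (r * f * carrierCost r f ^ 2), ?_⟩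
  intro m hm n hn W _ F hW hF V _ G hV P hq hS hcross
  have hsize : sizeBound r f t m ≤ n :=
    (Finset.le_sup (f := fun p : ℕ × ℕ × ℕ => sizeBound p.1 p.2.1 p.2.2 m) (b := (r, f, t))
      (by simp only [Finset.mem_product, Finset.mem_range]; omega)).trans hn
  subst hV hW
  have : Nonempty W := Fintype.card_pos_iff.1 hf
  obtain ⟨A, hAG, hA, hdeg, hAH⟩ := exists_absorbing_graph_le_crossing hF hr ht (by omega)
    (by omega) hsize hq hS (le_trans (by gcongr) hcross)
  have ht₀ : (t : ℝ) ≠ 0 := by positivity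
  refine ⟨A, hAG, hA, ?_, hAH⟩
  calc (A.maxDegree : ℝ) = (1 / t) ^ 2 * (A.maxDegree * t ^ 2) := by field_simp
    _ ≤ ε ^ 2 * Fintype.card V := by gcongr; exact_mod_cast hdeg

theorem lemma7p1 :
    ∃ n₀ : ℕ → ℕ, ∀ (r f : ℕ) (ε : ℝ), 1 ≤ r → 1 ≤ f → 0 < ε →
      ∃ m₀ : ℕ, ∀ m : ℕ, m₀ ≤ m → ∀ n : ℕ, n₀ m ≤ n →
        ∀ (W : Type*) [Fintype W] (F : SimpleGraph W),
          Fintype.card W = f → F.IsRegularOfDegree r →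
        ∀ (V : Type*) [Fintype V] (G : SimpleGraph V), Fintype.card V = n →
        ∀ P : Finpartition (Finset.univ : Finset V),
          P.IsEquipartition →
          P.parts.card = ⌈(n : ℝ) / (m : ℝ)⌉₊ →
          (∀ S ∈ P.parts, S.card = m ∨ S.card = m - 1) →
          (1 - 1 / (3 * (r : ℝ)) + ε) * (n : ℝ) ≤ ((GraphDecomp.crossing P G).minDegree : ℝ) →
          (∀ S ∈ P.parts, (1 - 1 / (3 * (r : ℝ)) + ε) * (S.card : ℝ) ≤
            ((G.induce (S : Set V)).minDegree : ℝ)) →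
          ∃ A : SimpleGraph V, A ≤ G ∧ GraphDecomp.IsDivisible F A ∧
            ((GraphDecomp.crossing P A).maxDegree : ℝ) ≤ ε ^ 2 * (n : ℝ) ∧
            (∀ S ∈ P.parts, (A.induce (S : Set V)).maxDegree ≤ r) ∧
            ∀ H : SimpleGraph V, GraphDecomp.IsDivisible F H →
              Disjoint A.edgeSet H.edgeSet →
              (GraphDecomp.crossing P H).edgeFinset.card = 0 →
              GraphDecomp.HasDecomposition F (A ⊔ H) := by
  obtain ⟨n₀, h⟩ := lemma7p1_general
  refine ⟨n₀, fun r f ε hr hf hε => (h r f ε hr hf hε).imp fun m₀ h => ?_⟩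
  intro m hm n hn W _ F hW hF V _ G hV P _ hq hS hG _
  obtain ⟨A, hAG, hA, hdeg, hAH⟩ := h m hm n hn W F hW hF V G hV P
    (hq ▸ (Nat.ceil_lt_add_one (by positivity)).le) (fun S hPS => by grind) hG
  refine ⟨A, hAG.trans (GraphDecomp.crossing_le P), hA, le_trans ?_ hdeg,
    fun S hPS => (GraphDecomp.maxDegree_induce_eq_zero_of_le_crossing hAG hPS).trans_le r.zero_le,
    fun H hH _ hPH => hAH H hH ?_⟩
  · exact Nat.cast_le.2 (SimpleGraph.maxDegree_mono (GraphDecomp.crossing_le P))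
  · simpa using hPH
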